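/- Let $\Gamma$ be a cofinite discrete subgroup of $\mathrm{SL}_2(\mathbb R)$, let $\mathfrak H$ be the upper half-plane, $\mathfrak H^*$ its union with the cusps of $\Gamma$ (the points of $\mathbb R\cup\{\infty\}$ fixed by a parabolic element of $\Gamma$), and $\mathfrak H^-$ the lower half-plane. For $\gamma=\begin{pmatrix}a&b\\c&d\end{pmatrix}$ and real $r$ the power $(cz+d)^r$ is taken with $\arg(cz+d)\in(-\pi,\pi]$ if $z\in\mathfrak H$, and $(ct+d)^r$ with $\arg(ct+d)\in[-\pi,\pi)$ if $t\in\mathfrak H^-$; $(\tau-t)^r$ with $\tau\in\mathfrak H$, $t\in\mathfrak H^-$ is the principal power. For $k\in\mathbb R$ and $v:\Gamma\to\mathbb C$, let $S_k(\Gamma,v)$ be the space of holomorphic $f:\mathfrak H\to\mathbb C$ with $f(\gamma z)=v(\gamma)(cz+d)^kf(z)$ for $\gamma\in\Gamma$ and with exponential decay at the cusps: for every $g=\begin{pmatrix}a&b\\c&d\end{pmatrix}\in\mathrm{SL}_2(\mathbb R)$ such that $g\infty$ is a cusp of $\Gamma$, $|cz+d|^{-k}|f(gz)|=O(e^{-\varepsilon\,\mathrm{Im}\,z})$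 as $\mathrm{Im}\,z\to\infty$, for some $\varepsilon>0$. A unitary multiplier system of weight $k$ is a map $v:\Gamma\to\mathbb C$ with $|v|=1$ for which $v(\gamma)(cz+d)^k$ is a factor of automorphy. Choose ($\mathcal A$) finitely many real numbers $w_1,\dots,w_\ell$ with $w_j+2>0$, unitary multiplier systems $v_j$ of weight $w_j+2$, and noncommuting variables $A_1,\dots,A_\ell$. For a monomial $B=A_{m_1}\cdots A_{m_d}$ put $w(B)=\sum_i w_{m_i}$ and $v(B)=\prod_i v_{m_i}$. Let $\mathcal O(\mathcal A)$ be the ring of formal power series in the $A_j$ whose coefficients are holomorphic functions $\varphi$ on $\mathfrak H^-$ with $\varphi(t)=O(|t|^a)+O(|\mathrm{Im}\,t|^{-a})$ for some $a\ge0$ and whose constant term is a constant function; let $\mathcal N(\mathcal A)$ be the set of its elements with constant term $1$. For $\gamma=\begin{pmatrix}a&b\\c&d\end{pmatrix}\in\Gamma$ the series $F|\gamma$ is obtained from $F$ by replacing the coefficient $\varphi$ of each monomial $B$ by $t\mapsto v(B)(\gamma)^{-1}(ct+d)^{w(B)}\varphi(\gamma t)$. Let $\mathcal B(\mathcal A)$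 be the set of monomials $B$ of positive degree with $S_{w(B)+2}(\Gamma,v(B))\ne0$, and $S(\mathcal A;\Gamma)=\prod_{B\in\mathcal B(\mathcal A)}S_{w(B)+2}(\Gamma,v(B))$. For $h\in S(\mathcal A;\Gamma)$, $x,y\in\mathfrak H^*$ and $t\in\mathfrak H^-$ put $$J(h;y,x;t)=1+\sum_{n\ge1}\ \sum_{B_1,\dots,B_n\in\mathcal B(\mathcal A)}R_n\bigl(h(B_1),\dots,h(B_n);y,x;t\bigr)\,B_1B_2\cdots B_n,$$ $$R_n(f_1,\dots,f_n;y,x;t)=\int_{\tau_1=x}^{y}f_1(\tau_1)(\tau_1-t)^{w(B_1)}\int_{\tau_2=x}^{\tau_1}f_2(\tau_2)(\tau_2-t)^{w(B_2)}\cdots\int_{\tau_n=x}^{\tau_{n-1}}f_n(\tau_n)(\tau_n-t)^{w(B_n)}\,d\tau_n\cdots d\tau_1\quad(f_j=h(B_j)),$$ where one integrates along a path from $x$ to $y$ that is $C^1$ in $\mathfrak H$, $C^1$ up to its end points in $\mathfrak H$, and runs monotonically along a geodesic half-line near an end point that is a cusp. Then, for every $h\in S(\mathcal A;\Gamma)$,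 these integrals converge absolutely and do not depend on the choice of the path, and $J(h;y,x;\cdot)\in\mathcal N(\mathcal A)$ for all $x,y\in\mathfrak H^*$. Moreover, for all $\gamma\in\Gamma$ and $x,y,z\in\mathfrak H^*$: $$J(h;\gamma^{-1}y,\gamma^{-1}x;\cdot)=J(h;y,x;\cdot)|\gamma,\qquad J(h;x,x;t)=1,$$ $$J(h;z,x;t)=J(h;z,y;t)\,J(h;y,x;t),\qquad J(h;x,y;t)=J(h;y,x;t)^{-1}.$$ -/

import Mathlib

open UpperHalfPlane Filter Topology MeasureTheory Set
open scoped MatrixGroups Manifold ComplexConjugate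

/-! ## Discrete groups, the extended upper half-plane, the lower half-plane -/

/-- `Γ` has finite covolume: some measurable set of finite hyperbolic area (`volume` on `ℍ` is
`dx dy / y ^ 2`) meets every `Γ`-orbit in `ℍ`. -/
def IsCofinite (Γ : Subgroup SL(2, ℝ)) : Prop :=
  ∃ F : Set ℍ, MeasurableSet F ∧ volume F < ⊤ ∧ ∀ z : ℍ, ∃ γ ∈ Γ, γ • z ∈ F

/-- `c ∈ ℝ ∪ {∞}` is a cusp of `Γ`, i.e. it is fixed by a parabolic element of `Γ`. -/
def IsCuspOf (Γ : Subgroup SL(2, ℝ)) (c : OnePoint ℝ) : Prop :=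
  IsCusp c (Γ.map Matrix.SpecialLinearGroup.toGL)

lemma IsCuspOf.smul {Γ : Subgroup SL(2, ℝ)} {c : OnePoint ℝ} (hc : IsCuspOf Γ c) (γ : Γ) :
    IsCuspOf Γ (Matrix.SpecialLinearGroup.toGL (γ : SL(2, ℝ)) • c) :=
  IsCusp.smul_of_mem hc ⟨γ, γ.2, rfl⟩

/-- The extended upper half-plane `ℍ* = ℍ ∪ {cusps of Γ}`. -/
inductive ExtUHP (Γ : Subgroup SL(2, ℝ)) : Type
  | point (z : ℍ) : ExtUHP Γ
  | cusp (c : OnePoint ℝ) (hc : IsCuspOf Γ c) : ExtUHP Γ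

/-- The action of `Γ` on `ℍ*` by Möbius transformations. -/
noncomputable instance (Γ : Subgroup SL(2, ℝ)) : MulAction Γ (ExtUHP Γ) where
  smul γ x := match x with
    | .point z => .point ((γ : SL(2, ℝ)) • z)
    | .cusp c hc => .cusp (Matrix.SpecialLinearGroup.toGL (γ : SL(2, ℝ)) • c) (hc.smul γ)
  one_smul x := by
    cases x with
    | point z => exact congrArg ExtUHP.point (one_smul _ z)
    | cusp c hc =>
      change ExtUHP.cusp _ _ = _
      simp
  mul_smul γ δ x := by
    cases x with
    | point z => exact congrArg ExtUHP.point (mul_smul _ _ z)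
    | cusp c hc =>
      change ExtUHP.cusp _ _ = ExtUHP.cusp _ _
      simp [mul_smul]

/-- The lower half-plane. -/
def LHP : Type := {t : ℂ // t.im < 0}

/-- The action of a matrix in `SL(2, ℝ)` on the lower half-plane,
`t ↦ (a t + b) / (c t + d)`. -/
noncomputable def LHP.moebius (g : SL(2, ℝ)) (t : LHP) : LHP :=
  ⟨((g 0 0 : ℂ) * t.1 + (g 0 1 : ℂ)) / ((g 1 0 : ℂ) * t.1 + (g 1 1 : ℂ)), by
    have h := moebius_im (Matrix.SpecialLinearGroup.toGL g) t.1
    have h1 : (num (Matrix.SpecialLinearGroup.toGL g) t.1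
        / denom (Matrix.SpecialLinearGroup.toGL g) t.1).im < 0 := by
      rw [h]
      have := normSq_denom_pos (Matrix.SpecialLinearGroup.toGL g) t.2.ne
      apply div_neg_of_neg_of_pos _ this
      simpa using t.2
    exact h1⟩

/-- The power `z ^ r` with the argument of `z` taken in `[-π, π)`.  (Mathlib's `z ^ r` takes the
argument in `(-π, π]`.)  This is the convention for `(c t + d) ^ r` with `t` in the lower
half-plane; it differs from the principal one only for `z` on the negative real axis. -/
noncomputable def cpowLower (z : ℂ) (r : ℝ) : ℂ := conj ((conj z) ^ (r : ℂ))

/-! ## Multiplier systems and cusp forms -/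

/-- The automorphy factor `(c z + d) ^ k` for `z ∈ ℍ`, the argument taken in `(-π, π]`. -/
noncomputable def autFactor (k : ℝ) (g : SL(2, ℝ)) (z : ℍ) : ℂ :=
  (denom (Matrix.SpecialLinearGroup.toGL g) z) ^ (k : ℂ)

/-- `v` is a unitary multiplier system on `Γ` for the weight `k`:
`v(γ) (c z + d) ^ k` is a factor of automorphy and `|v(γ)| = 1`. -/
structure IsUnitaryMultiplier (Γ : Subgroup SL(2, ℝ)) (k : ℝ) (v : Γ → ℂ) : Prop where
  norm_eq_one : ∀ γ, ‖v γ‖ = 1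
  cocycle : ∀ (γ δ : Γ) (z : ℍ),
    v (γ * δ) * autFactor k ((γ * δ : Γ) : SL(2, ℝ)) z =
      (v γ * autFactor k γ ((δ : SL(2, ℝ)) • z)) * (v δ * autFactor k δ z)

/-- Exponential decay of `f : ℍ → ℂ` (in weight `k`) on approach of the cusps of `Γ`:
if `g ∞` is a cusp, then `(c z + d) ^ (-k) f (g z) = O(exp (-ε Im z))` as `Im z → ∞`,
for some `ε > 0`. -/
def HasCuspDecay (Γ : Subgroup SL(2, ℝ)) (k : ℝ) (f : ℍ → ℂ) : Prop :=
  ∀ g : SL(2, ℝ), IsCuspOf Γ (Matrix.SpecialLinearGroup.toGL g • OnePoint.infty) →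
    ∃ ε : ℝ, 0 < ε ∧
      (fun z : ℍ => ‖denom (Matrix.SpecialLinearGroup.toGL g) z‖ ^ (-k) * ‖f (g • z)‖)
        =O[atImInfty] fun z : ℍ => Real.exp (-ε * z.im)

/-- The space `S_k(Γ, v)` of holomorphic cusp forms of weight `k` with multiplier system `v`. -/
noncomputable def cuspForms (Γ : Subgroup SL(2, ℝ)) (k : ℝ) (v : Γ → ℂ) :
    Submodule ℂ (ℍ → ℂ) where
  carrier := {f | MDiff f ∧
    (∀ (γ : Γ) (z : ℍ), f ((γ : SL(2, ℝ)) • z) = v γ * autFactor k γ z * f z) ∧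
    HasCuspDecay Γ k f}
  zero_mem' := by
    refine ⟨mdifferentiable_const, by simp, fun g _ => ⟨1, one_pos, ?_⟩⟩
    simpa using Asymptotics.isBigO_zero _ _
  add_mem' := by
    rintro f₁ f₂ ⟨h₁, h₁', h₁''⟩ ⟨h₂, h₂', h₂''⟩
    refine ⟨h₁.add h₂, fun γ z => by simp [h₁', h₂', mul_add], fun g hg => ?_⟩
    obtain ⟨ε₁, hε₁, H₁⟩ := h₁'' g hg
    obtain ⟨ε₂, hε₂, H₂⟩ := h₂'' g hg
    have key : ∀ ε' : ℝ, min ε₁ ε₂ ≤ ε' →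
        (fun z : ℍ => Real.exp (-ε' * z.im)) =O[atImInfty]
          fun z : ℍ => Real.exp (-(min ε₁ ε₂) * z.im) := by
      intro ε' h
      refine Asymptotics.isBigO_of_le _ fun z => ?_
      rw [Real.norm_of_nonneg (Real.exp_pos _).le, Real.norm_of_nonneg (Real.exp_pos _).le,
        Real.exp_le_exp]
      have := z.im_pos
      nlinarith
    refine ⟨min ε₁ ε₂, lt_min hε₁ hε₂, ?_⟩
    refine Asymptotics.IsBigO.trans (Asymptotics.isBigO_of_le _ fun z => ?_)
      ((H₁.trans (key _ (min_le_left _ _))).add (H₂.trans (key _ (min_le_right _ _))))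
    rw [← mul_add, norm_mul, norm_mul]
    refine mul_le_mul_of_nonneg_left ?_ (norm_nonneg _)
    rw [norm_norm, Real.norm_of_nonneg (by positivity)]
    exact norm_add_le _ _
  smul_mem' := by
    rintro a f ⟨h, h', h''⟩
    refine ⟨h.const_smul a, fun γ z => by simp [h']; ring, fun g hg => ?_⟩
    obtain ⟨ε, hε, H⟩ := h'' g hg
    refine ⟨ε, hε, ?_⟩
    refine (H.const_mul_left ‖a‖).congr_left fun z => ?_
    simp only [Pi.smul_apply, smul_eq_mul, norm_mul]
    ring

/-- The choice `𝒜` of `ℓ` positive weights `w j + 2` together with corresponding unitary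
multiplier systems `v j` on `Γ`. -/
structure WeightSystem (Γ : Subgroup SL(2, ℝ)) (ℓ : ℕ) where
  w : Fin ℓ → ℝ
  v : Fin ℓ → Γ → ℂ
  weight_pos : ∀ j, 0 < w j + 2
  isMultiplier : ∀ j, IsUnitaryMultiplier Γ (w j + 2) (v j)

namespace WeightSystem

variable {Γ : Subgroup SL(2, ℝ)} {ℓ : ℕ} (A : WeightSystem Γ ℓ)

/-- The shifted weight `w(m) = w_{m₁} + ⋯ + w_{mₙ}` of the monomial `A_{m₁} ⋯ A_{mₙ}`.
The monomials in the noncommuting variables `A_j` are the words in `Fin ℓ`. -/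
def wt (m : List (Fin ℓ)) : ℝ := (m.map A.w).sum

/-- The multiplier system `v(m) = v_{m₁} ⋯ v_{mₙ}` of a monomial. -/
def mult (m : List (Fin ℓ)) (γ : Γ) : ℂ := (m.map fun j => A.v j γ).prod

/-- The set `ℬ(𝒜)` of monomials `B` of positive degree with `S_{w(B)+2}(Γ, v(B)) ≠ 0`. -/
def monomials : Set (List (Fin ℓ)) :=
  {B | B ≠ [] ∧ cuspForms Γ (A.wt B + 2) (A.mult B) ≠ ⊥}

/-- `S(𝒜; Γ)`, the product over `B ∈ ℬ(𝒜)` of the spaces `S_{w(B)+2}(Γ, v(B))`. -/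
abbrev CuspFamily : Type := (B : A.monomials) → cuspForms Γ (A.wt B + 2) (A.mult B)

end WeightSystem

/-! ## Formal power series in noncommuting variables -/

/-- Formal power series in `ℓ` noncommuting variables: `F m` is the coefficient of the
monomial `A_{m₁} ⋯ A_{mₙ}`. -/
def NCSeries (ℓ : ℕ) (R : Type*) : Type _ := List (Fin ℓ) → R

namespace NCSeries

variable {ℓ : ℕ} {R : Type*} [CommSemiring R]

@[ext] lemma ext {R : Type*} {F G : NCSeries ℓ R} (h : ∀ m, F m = G m) : F = G := funext h

instance : One (NCSeries ℓ R) := ⟨fun m => if m = [] then 1 else 0⟩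

/-- The product: the coefficient of `m` is the sum over all ways to write `m` as a
concatenation of two words. -/
instance : Mul (NCSeries ℓ R) :=
  ⟨fun F G m => ∑ i ∈ Finset.range (m.length + 1), F (m.take i) * G (m.drop i)⟩

lemma one_apply (m : List (Fin ℓ)) : (1 : NCSeries ℓ R) m = if m = [] then 1 else 0 := rfl

lemma mul_apply (F G : NCSeries ℓ R) (m : List (Fin ℓ)) :
    (F * G) m = ∑ i ∈ Finset.range (m.length + 1), F (m.take i) * G (m.drop i) := rfl

instance : Monoid (NCSeries ℓ R) where
  one_mul F := by
    ext m
    rw [mul_apply, Finset.sum_eq_single 0]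
    · simp [one_apply]
    · intro i hi hi0
      rw [Finset.mem_range] at hi
      have : m.take i ≠ [] := by
        intro h
        have := congrArg List.length h
        simp at this
        rcases this with h | h
        · exact hi0 h
        · subst h; simp at hi; omega
      simp [one_apply, this]
    · simp
  mul_one F := by
    ext m
    rw [mul_apply, Finset.sum_eq_single m.length]
    · simp [one_apply]
    · intro i hi hi0
      rw [Finset.mem_range] at hi
      have : m.drop i ≠ [] := by
        intro h
        have := congrArg List.length h
        simp at this
        omega
      simp [one_apply, this]
    · simp
  mul_assoc F G H := by
    ext m
    simp only [mul_apply, Finset.sum_mul, Finset.mul_sum]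
    rw [Finset.sum_sigma', Finset.sum_sigma']
    refine Finset.sum_bij' (fun a _ => ⟨a.2, a.1 - a.2⟩) (fun b _ => ⟨b.1 + b.2, b.1⟩)
      ?_ ?_ ?_ ?_ ?_
    · rintro ⟨i, j⟩ h
      simp only [Finset.mem_sigma, Finset.mem_range, List.length_take, List.length_drop] at h ⊢
      omega
    · rintro ⟨i, j⟩ h
      simp only [Finset.mem_sigma, Finset.mem_range, List.length_take, List.length_drop] at h ⊢
      omega
    · rintro ⟨i, j⟩ h
      simp only [Finset.mem_sigma, Finset.mem_range, List.length_take] at h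
      simp only [Sigma.mk.injEq, heq_eq_eq, and_true]
      omega
    · rintro ⟨i, j⟩ h
      simp
    · rintro ⟨i, j⟩ h
      simp only [Finset.mem_sigma, Finset.mem_range, List.length_take] at h
      have hj : j ≤ i := by omega
      rw [List.take_take, min_eq_left hj, List.drop_take, List.drop_drop,
        show j + (i - j) = i by omega, mul_assoc]

end NCSeries

/-- A function on the lower half-plane is holomorphic with at most polynomial growth:
`φ(t) = O(|t| ^ a) + O(|Im t| ^ (-a))` for some `a ≥ 0`. -/
def IsPolyGrowth (φ : LHP → ℂ) : Prop :=
  DifferentiableOn ℂ (Function.extend (fun t : LHP => t.1) φ 0) {t : ℂ | t.im < 0} ∧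
  ∃ a C : ℝ, 0 ≤ a ∧ ∀ t : LHP, ‖φ t‖ ≤ C * (‖t.1‖ ^ a + |t.1.im| ^ (-a))

namespace WeightSystem

variable {Γ : Subgroup SL(2, ℝ)} {ℓ : ℕ} (A : WeightSystem Γ ℓ)

/-- The set `𝒪(𝒜)` of formal power series all of whose coefficients are holomorphic functions
with at most polynomial growth on the lower half-plane, with constant term in `ℂ`. -/
def seriesRing (_A : WeightSystem Γ ℓ) : Set (NCSeries ℓ (LHP → ℂ)) :=
  {F | (∀ m, IsPolyGrowth (F m)) ∧ ∃ c : ℂ, F [] = fun _ => c}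

/-- The set `𝒩(𝒜)` of elements of `𝒪(𝒜)` with constant term `1`. -/
def unipotent : Set (NCSeries ℓ (LHP → ℂ)) := {F | F ∈ A.seriesRing ∧ F [] = 1}

/-- The right action `F ↦ F|γ` on formal power series with coefficients functions on the lower
half-plane: on the coefficient `φ` of the monomial `m` it is
`(φ|γ)(t) = v(m)(γ)⁻¹ (c t + d) ^ w(m) φ(γ t)`. -/
noncomputable def slash (F : NCSeries ℓ (LHP → ℂ)) (γ : Γ) : NCSeries ℓ (LHP → ℂ) :=
  fun m t => (A.mult m γ)⁻¹ *
    cpowLower (((γ : SL(2, ℝ)) 1 0 : ℂ) * t.1 + ((γ : SL(2, ℝ)) 1 1 : ℂ)) (A.wt m) *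
    F m (t.moebius γ)

end WeightSystem

/-! ## Paths in the extended upper half-plane and iterated integrals -/

/-- A path `p`, parametrized by `(0, 1)`, starts at `x ∈ ℍ*` (for `s ↓ 0`).  If `x ∈ ℍ`, then
`p 0 = x` and `p` is `C¹` up to `0`.  If `x` is a cusp, then near `s = 0` the path runs
(monotonically) along a geodesic half-line `g (i u)`, `u → ∞`, to the cusp `x = g ∞`. -/
def StartsAt {Γ : Subgroup SL(2, ℝ)} (p : ℝ → ℍ) : ExtUHP Γ → Prop
  | .point z => p 0 = z ∧ ContDiffWithinAt ℝ 1 (fun s => (p s : ℂ)) (Ici 0) 0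
  | .cusp c _ => ∃ g : SL(2, ℝ), Matrix.SpecialLinearGroup.toGL g • OnePoint.infty = c ∧
      ∃ (u : ℝ → ℝ) (δ : ℝ), 0 < δ ∧ AntitoneOn u (Ioo 0 δ) ∧ Tendsto u (𝓝[>] 0) atTop ∧
        ∀ s ∈ Ioo 0 δ, 0 < u s ∧ p s = g • ofComplex (Complex.I * u s)

/-- `p` is an admissible path from `x` to `y` in `ℍ*`: it is a `C¹` path in `ℍ` on `(0, 1)`,
it starts at `x`, and the reversed path starts at `y`. -/
structure IsPathFromTo {Γ : Subgroup SL(2, ℝ)} (p : ℝ → ℍ) (x y : ExtUHP Γ) : Prop where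
  contDiffOn : ContDiffOn ℝ 1 (fun s => (p s : ℂ)) (Ioo 0 1)
  startsAt : StartsAt p x
  endsAt : StartsAt (fun s => p (1 - s)) y

/-- The integrand `f(τ) (τ - t) ^ w F dτ` pulled back along a path. -/
noncomputable def pathIntegrand (p : ℝ → ℍ) (t : LHP) (f : ℍ → ℂ) (w : ℝ) (F : ℝ → ℂ)
    (s : ℝ) : ℂ :=
  f (p s) * ((p s : ℂ) - t.1) ^ (w : ℂ) * F s * deriv (fun r => (p r : ℂ)) s

/-- The iterated integral, along the path `p` from its starting point up to the point `p s`,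
`∫ f₁(τ₁) (τ₁ - t) ^ w₁ ∫^{τ₁} f₂(τ₂) (τ₂ - t) ^ w₂ ⋯ ∫^{τₙ₋₁} fₙ(τₙ) (τₙ - t) ^ wₙ dτₙ ⋯ dτ₁`,
for a list of pairs `(fⱼ, wⱼ)`.  It is `1` for the empty list. -/
noncomputable def iterInt (p : ℝ → ℍ) (t : LHP) : List ((ℍ → ℂ) × ℝ) → ℝ → ℂ
  | [], _ => 1
  | (f, w) :: L, s => ∫ r in (0 : ℝ)..s, pathIntegrand p t f w (iterInt p t L) r

/-- All the integrals that occur in the iterated integral along `p` converge absolutely. -/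
def IterConverges (p : ℝ → ℍ) (t : LHP) : List ((ℍ → ℂ) × ℝ) → Prop
  | [] => True
  | (f, w) :: L =>
    IntervalIntegrable (pathIntegrand p t f w (iterInt p t L)) volume 0 1 ∧ IterConverges p t L

/-- Near the starting point the standard path follows `endRay`: it is constant at a point of `ℍ`,
and it is a vertical half-line at a cusp. -/
noncomputable def endRay {Γ : Subgroup SL(2, ℝ)} : ExtUHP Γ → ℝ → ℂ
  | .point z, _ => z
  | .cusp c _, s => c.elim (Complex.I / s) (fun r => r + Complex.I * s)

/-- A standard path from `x` to `y` in `ℍ*`: a smooth convex combination of the end rays. -/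
noncomputable def stdPath {Γ : Subgroup SL(2, ℝ)} (x y : ExtUHP Γ) (s : ℝ) : ℍ :=
  ofComplex ((1 - Real.smoothTransition (3 * s - 1) : ℝ) * endRay x s +
    (Real.smoothTransition (3 * s - 1) : ℝ) * endRay y (1 - s))

lemma endRay_im_pos {Γ : Subgroup SL(2, ℝ)} (x : ExtUHP Γ) {s : ℝ} (hs : 0 < s) :
    0 < (endRay x s).im := by
  cases x with
  | point z => exact z.im_pos
  | cusp c hc =>
    cases c with
    | infty => simpa [endRay] using hs
    | coe r => simpa [endRay] using hs

lemma contDiffAt_endRay {Γ : Subgroup SL(2, ℝ)} (x : ExtUHP Γ) {s : ℝ} (hs : 0 < s) :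
    ContDiffAt ℝ 1 (endRay x) s := by
  have h : ContDiffAt ℝ 1 (fun s : ℝ => (s : ℂ)) s := Complex.ofRealCLM.contDiff.contDiffAt
  cases x with
  | point z => exact contDiffAt_const
  | cusp c hc =>
    cases c with
    | infty =>
      change ContDiffAt ℝ 1 (fun s : ℝ => Complex.I / (s : ℂ)) s
      have hs' : (s : ℂ) ≠ 0 := by exact_mod_cast hs.ne'
      simp only [div_eq_mul_inv]
      exact contDiffAt_const.mul (h.inv hs')
    | coe r =>
      change ContDiffAt ℝ 1 (fun s : ℝ => (r : ℂ) + Complex.I * (s : ℂ)) s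
      exact contDiffAt_const.add (contDiffAt_const.mul h)

lemma startsAt_of_endRay {Γ : Subgroup SL(2, ℝ)} (x : ExtUHP Γ) (p : ℝ → ℍ)
    (hp : ∀ s < 1 / 3, p s = ofComplex (endRay x s)) : StartsAt p x := by
  cases x with
  | point z =>
    have h : ∀ s < (1 / 3 : ℝ), p s = z := fun s hs => by
      rw [hp s hs]; exact ofComplex_apply z
    refine ⟨h 0 (by norm_num), ContDiffAt.contDiffWithinAt ?_⟩
    refine (contDiffAt_const (c := (z : ℂ))).congr_of_eventuallyEq ?_
    filter_upwards [Iio_mem_nhds (show (0 : ℝ) < 1 / 3 by norm_num)] with s hs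
    rw [h s hs]
  | cusp c hc =>
    have hanti : AntitoneOn (fun s : ℝ => s⁻¹) (Ioo 0 (1 / 3)) := fun a ha b _ hab =>
      inv_anti₀ ha.1 hab
    cases c with
    | infty =>
      refine ⟨1, by simp, fun s => s⁻¹, 1 / 3, by norm_num, hanti, tendsto_inv_nhdsGT_zero, ?_⟩
      rintro s ⟨hs0, hs⟩
      refine ⟨inv_pos.2 hs0, ?_⟩
      rw [hp s hs, one_smul]
      simp [endRay, div_eq_mul_inv]
    | coe r =>
      have hdet : (!![r, -1; 1, 0] : Matrix (Fin 2) (Fin 2) ℝ).det = 1 := by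
        simp [Matrix.det_fin_two]
      obtain ⟨g, hg⟩ : ∃ g : SL(2, ℝ), (g : Matrix (Fin 2) (Fin 2) ℝ) = !![r, -1; 1, 0] :=
        ⟨⟨_, hdet⟩, rfl⟩
      refine ⟨g, ?_, fun s => s⁻¹, 1 / 3, by norm_num, hanti, tendsto_inv_nhdsGT_zero, ?_⟩
      · rw [OnePoint.smul_infty_eq_ite]
        simp [Matrix.SpecialLinearGroup.toGL, hg]
      · rintro s ⟨hs0, hs⟩
        refine ⟨inv_pos.2 hs0, ?_⟩
        have him : 0 < (Complex.I * ((s⁻¹ : ℝ) : ℂ)).im := by simpa using hs0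
        have hs' : (s : ℂ) ≠ 0 := by exact_mod_cast hs0.ne'
        rw [hp s hs]
        ext1
        rw [coe_specialLinearGroup_apply, ofComplex_apply_of_im_pos him,
          ofComplex_apply_of_im_pos (endRay_im_pos _ hs0)]
        simp [endRay, hg]
        field_simp
        ring_nf
        simp
        ring

/-- Any two points of `ℍ*` are joined by an admissible path. -/
theorem isPathFromTo_stdPath {Γ : Subgroup SL(2, ℝ)} (x y : ExtUHP Γ) :
    IsPathFromTo (stdPath x y) x y where
  contDiffOn := by
    intro s hs
    apply ContDiffAt.contDiffWithinAt
    set q : ℝ → ℂ := fun s => (1 - Real.smoothTransition (3 * s - 1) : ℝ) * endRay x s +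
      (Real.smoothTransition (3 * s - 1) : ℝ) * endRay y (1 - s) with hq
    have hχ : ContDiffAt ℝ 1 (fun s : ℝ => Real.smoothTransition (3 * s - 1)) s :=
      Real.smoothTransition.contDiffAt.comp s (by fun_prop)
    have hof : ∀ {φ : ℝ → ℝ}, ContDiffAt ℝ 1 φ s → ContDiffAt ℝ 1 (fun s => (φ s : ℂ)) s :=
      fun h => Complex.ofRealCLM.contDiff.contDiffAt.comp s h
    have hqc : ContDiffAt ℝ 1 q s :=
      ((hof (contDiffAt_const.sub hχ)).mul (contDiffAt_endRay x hs.1)).add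
        ((hof hχ).mul (ContDiffAt.comp s
          (contDiffAt_endRay y (show 0 < 1 - s by linarith [hs.2])) (by fun_prop)))
    refine hqc.congr_of_eventuallyEq ?_
    filter_upwards [Ioo_mem_nhds hs.1 hs.2] with r hr
    have hpos : 0 < (q r).im := by
      have h1 := endRay_im_pos x hr.1
      have h2 := endRay_im_pos y (show 0 < 1 - r by linarith [hr.2])
      have h3 := Real.smoothTransition.nonneg (3 * r - 1)
      have h4 := Real.smoothTransition.le_one (3 * r - 1)
      simp only [hq, Complex.add_im, Complex.im_ofReal_mul]
      rcases h3.eq_or_lt with h | h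
      · rw [← h]; simpa using h1
      · have := mul_pos h h2
        have := mul_nonneg (sub_nonneg.2 h4) h1.le
        linarith
    change ((ofComplex (q r) : ℍ) : ℂ) = q r
    rw [ofComplex_apply_of_im_pos hpos]
  startsAt := startsAt_of_endRay x _ fun s hs => by
    rw [stdPath, Real.smoothTransition.zero_of_nonpos (by linarith)]
    simp
  endsAt := startsAt_of_endRay y _ fun s hs => by
    rw [stdPath, Real.smoothTransition.one_of_one_le (by linarith)]
    simp

/-! ## The formal series `J(h; y, x; t)` -/

namespace WeightSystem

variable {Γ : Subgroup SL(2, ℝ)} {ℓ : ℕ} {A : WeightSystem Γ ℓ}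

/-- The list of pairs `(h(Bⱼ), w(Bⱼ))` for monomials `B₁, …, Bₙ ∈ ℬ(𝒜)`. -/
def CuspFamily.factors (h : A.CuspFamily) (L : List A.monomials) : List ((ℍ → ℂ) × ℝ) :=
  L.map fun B => ((h B : ℍ → ℂ), A.wt B)

/-- The iterated integral `R_n(h(B₁), …, h(Bₙ); y, x; t)` from `x` to `y`. -/
noncomputable def CuspFamily.R (h : A.CuspFamily) (L : List A.monomials) (y x : ExtUHP Γ)
    (t : LHP) : ℂ :=
  iterInt (stdPath x y) t (h.factors L) 1

/-- A monomial has only finitely many factorizations `m = B₁ ⋯ Bₙ` with `Bⱼ ∈ ℬ(𝒜)`. -/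
lemma finite_factorizations (A : WeightSystem Γ ℓ) (m : List (Fin ℓ)) :
    {L : List A.monomials | (L.map Subtype.val).flatten = m}.Finite := by
  have hN : ∀ N : ℕ, {B : A.monomials | B.1.length ≤ N}.Finite := fun N =>
    Set.Finite.preimage (Subtype.val_injective.injOn) (List.finite_length_le (Fin ℓ) N)
  have key : ∀ n N : ℕ, {L : List A.monomials | L.length ≤ n ∧
      ∀ B ∈ L, B.1.length ≤ N}.Finite := by
    intro n N
    induction n with
    | zero =>
      refine (Set.finite_singleton []).subset ?_
      rintro L ⟨hL, -⟩
      simpa using hL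
    | succ n ih =>
      refine ((Set.finite_singleton []).union
        (Set.Finite.image2 List.cons (hN N) ih)).subset ?_
      rintro L ⟨hL, hB⟩
      cases L with
      | nil => simp
      | cons B L =>
        right
        refine ⟨B, hB B (by simp), L, ⟨by simpa using hL, fun B' h' => hB B' (by simp [h'])⟩, rfl⟩
  have hlen : ∀ L : List A.monomials, L.length ≤ ((L.map Subtype.val).flatten).length ∧
      ∀ B ∈ L, B.1.length ≤ ((L.map Subtype.val).flatten).length := by
    intro L
    induction L with
    | nil => simp
    | cons B L ih =>
      have hB : 0 < B.1.length := List.length_pos_iff.2 B.2.1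
      simp only [List.map_cons, List.flatten_cons, List.length_append, List.length_cons,
        List.mem_cons, forall_eq_or_imp]
      refine ⟨by omega, by omega, fun B' h' => ?_⟩
      have := ih.2 B' h'
      omega
  refine (key m.length m.length).subset ?_
  rintro L rfl
  exact hlen L

/-- The formal series
`J(h; y, x; t) = 1 + ∑_{n ≥ 1} ∑_{B₁, …, Bₙ ∈ ℬ(𝒜)} R_n(h(B₁), …, h(Bₙ); y, x; t) B₁ ⋯ Bₙ`.
The coefficient of a monomial `m` collects the finitely many terms with `B₁ ⋯ Bₙ = m`;
the term `1` is the one for `n = 0`. -/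
noncomputable def CuspFamily.J (h : A.CuspFamily) (y x : ExtUHP Γ) : NCSeries ℓ (LHP → ℂ) :=
  fun m t => ∑ᶠ L ∈ {L : List A.monomials | (L.map Subtype.val).flatten = m}, h.R L y x t

end WeightSystem

open Matrix.SpecialLinearGroup (toGL)

/-! ## Möbius transformations -/

/-! The iterated integrals are replaced by iterated primitives. For fixed `t` the form f(τ)(τ-t)^w
G(τ) dτ is holomorphic on the convex set ℍ, so it has a primitive. Near a cusp, inside vertical
strips transported to it, exponential decay of f gives this primitive a limit. Normalizing the limit
at x to be 0 and iterating defines `iterPrim`. By the fundamental theorem of calculus the integral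
along any admissible path from x to y is the limit of `iterPrim` at y (`iterInt_one_eq`), which
proves independence of the path.

The algebraic identities rest on a uniqueness principle (`eq_of_hasDerivAt_of_tendsto`): two
functions on ℍ with the same derivative and the same limit at one point of ℍ* coincide. Equivariance
(`iterPrim_smul`) compares derivatives under τ ↦ γτ: the weight w+2 of f cancels dγτ = (cτ+d)^(-2)
dτ up to (cτ+d)^w. By `moebius_sub_cpow`, which checks the branches, this turns (γτ-γt)^w into
(τ-t)^w up to (ct+d)^(-w). Composition of paths (`iterPrim_split`) is Chen's deconcatenation
formula; summed over all factorizations of a word it becomes the product formula for J. The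
integrals from x to x vanish, so J(x,x) = 1, and inverses follow from the product formula.

The analytic half stays with path integrals. The majorant |f(τ)|(1+|τ|)^a |dτ| is integrable along
admissible paths (`integrableOn_pathMajorant`), and |(τ-t)^w| is at most a power of 1+|τ| times a
power of `lhpSize t`. By induction this gives convergence and polynomial growth in t
(`exists_bound_iterInt`); dominated differentiation under the integral gives holomorphy
(`differentiableOn_iterInt`). -/

lemma coe_sl_smul (g : SL(2, ℝ)) (z : ℍ) :
    ((g • z : ℍ) : ℂ) = ((g 0 0 : ℂ) * z + g 0 1) / denom (toGL g) z := by
  rw [coe_specialLinearGroup_apply]; simp [denom]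

lemma denom_toGL (g : SL(2, ℝ)) (z : ℂ) : denom (toGL g) z = (g 1 0 : ℂ) * z + g 1 1 := by
  simp [denom]

lemma sl_det (g : SL(2, ℝ)) : g 0 0 * g 1 1 - g 0 1 * g 1 0 = 1 := by
  rw [← Matrix.det_fin_two]; exact g.2

lemma hasDerivAt_sl_smul (g : SL(2, ℝ)) (z : ℍ) :
    HasDerivAt (fun w : ℂ => ((g • ofComplex w : ℍ) : ℂ)) (1 / denom (toGL g) z ^ 2) z := by
  have h := (hasStrictDerivAt_smul (g := toGL g) (by simp) z).hasDerivAt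
  rw [show (toGL g).val.det = 1 by simp, Complex.ofReal_one] at h
  exact h

lemma hasDerivAt_comp_sl_smul {F : ℍ → ℂ} {F' : ℂ} (g : SL(2, ℝ)) (z : ℍ)
    (h : HasDerivAt (F ∘ ofComplex) F' ((g • z : ℍ) : ℂ)) :
    HasDerivAt ((fun τ => F (g • τ)) ∘ ofComplex) (F' * (1 / denom (toGL g) z ^ 2)) z := by
  have h1 := hasDerivAt_sl_smul g z
  have h2 : HasDerivAt (F ∘ ofComplex) F' ((g • ofComplex (z : ℂ) : ℍ) : ℂ) := by
    rwa [ofComplex_apply]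
  have h3 := HasDerivAt.comp (z : ℂ) h2 h1
  refine h3.congr_of_eventuallyEq (Eventually.of_forall fun w => ?_)
  simp [ofComplex_apply]

/-! ## Neighbourhoods in the extended upper half-plane -/

/-- The filter of vertical strips of width `2 M` going up to `∞`. -/
def stripFilter (M : ℝ) : Filter ℍ := atImInfty ⊓ 𝓟 {z | |z.re| ≤ M}

/-- The trace on `ℍ` of the neighbourhoods of a point of `ℍ*`; cusps are approached inside
vertical strips, transported to the cusp. -/
noncomputable def extNhds {Γ : Subgroup SL(2, ℝ)} : ExtUHP Γ → Filter ℍ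
  | .point z => 𝓝 z
  | .cusp c _ => ⨆ (g : SL(2, ℝ)) (_ : toGL g • OnePoint.infty = c) (M : ℝ),
      map (fun z => g • z) (stripFilter M)

lemma mem_stripFilter {M : ℝ} {S : Set ℍ} :
    S ∈ stripFilter M ↔ ∃ Y : ℝ, ∀ z : ℍ, |z.re| ≤ M → Y ≤ z.im → z ∈ S := by
  rw [stripFilter, mem_inf_principal, atImInfty_mem]
  exact ⟨fun ⟨Y, h⟩ => ⟨Y, fun z h1 h2 => h z h2 h1⟩, fun ⟨Y, h⟩ => ⟨Y, fun z h1 h2 => h z h2 h1⟩⟩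

lemma eventually_stripFilter {M : ℝ} {P : ℍ → Prop} :
    (∀ᶠ z in stripFilter M, P z) ↔ ∃ Y : ℝ, ∀ z : ℍ, |z.re| ≤ M → Y ≤ z.im → P z :=
  mem_stripFilter

lemma tendsto_extNhds_cusp {Γ : Subgroup SL(2, ℝ)} {c : OnePoint ℝ} {hc : IsCuspOf Γ c}
    {α : Type*} {F : ℍ → α} {l : Filter α} :
    Tendsto F (extNhds (.cusp c hc)) l ↔ ∀ g : SL(2, ℝ), toGL g • OnePoint.infty = c →
      ∀ M, Tendsto (fun z => F (g • z)) (stripFilter M) l := by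
  simp only [extNhds, tendsto_iSup, tendsto_map'_iff, Function.comp_def]

/-- If g parametrizes the cusp c, then γg parametrizes γc. Since `extNhds` runs over all
parametrizations of a cusp, equivariance needs no comparison between them. -/
lemma tendsto_smul_extNhds {Γ : Subgroup SL(2, ℝ)} (γ : Γ) (x : ExtUHP Γ) :
    Tendsto (fun z : ℍ => (γ : SL(2, ℝ)) • z) (extNhds x) (extNhds (γ • x)) := by
  cases x with
  | point z =>
    change Tendsto _ (𝓝 z) (𝓝 ((γ : SL(2, ℝ)) • z))
    exact (continuous_const_smul (toGL (γ : SL(2, ℝ)))).tendsto z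
  | cusp c hc =>
    rw [tendsto_extNhds_cusp]
    intro g hg M
    change Tendsto _ _ (extNhds (.cusp (toGL (γ : SL(2, ℝ)) • c) (hc.smul γ)))
    have key := (tendsto_extNhds_cusp (hc := hc.smul γ) (F := id)
      (l := extNhds (.cusp (toGL (γ : SL(2, ℝ)) • c) (hc.smul γ)))).1 tendsto_id
      ((γ : SL(2, ℝ)) * g) (by rw [map_mul, mul_smul, hg]) M
    simpa only [mul_smul, id] using key

/-- Two parametrizations of a cusp differ by an upper triangular matrix, which respects strips. -/
lemma tendsto_stripFilter_of_apply_one_zero {T : SL(2, ℝ)} (hT : T 1 0 = 0) (M : ℝ) :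
    ∃ M', Tendsto (fun z : ℍ => T • z) (stripFilter M) (stripFilter M') := by
  have hdet := sl_det T
  rw [hT, mul_zero, sub_zero] at hdet
  have hd : T 1 1 ≠ 0 := right_ne_zero_of_mul_eq_one hdet
  have hcoe : ∀ z : ℍ, ((T • z : ℍ) : ℂ) = ((T 0 0 / T 1 1 : ℝ) : ℂ) * z + ((T 0 1 / T 1 1 : ℝ) : ℂ) := by
    intro z
    rw [coe_sl_smul, denom_toGL, hT]
    push_cast
    simp only [zero_mul, zero_add]
    ring
  have ha : 0 < T 0 0 / T 1 1 := by
    have : T 0 0 / T 1 1 = (T 1 1)⁻¹ ^ 2 := by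
      field_simp; linarith
    rw [this]; positivity
  refine ⟨(T 0 0 / T 1 1) * M + |T 0 1 / T 1 1|, ?_⟩
  rw [Tendsto]
  intro S hS
  obtain ⟨Y, hY⟩ := mem_stripFilter.1 hS
  rw [mem_map, mem_stripFilter]
  refine ⟨Y / (T 0 0 / T 1 1), fun z hz hz' => hY _ ?_ ?_⟩
  · have : (T • z : ℍ).re = (T 0 0 / T 1 1) * z.re + T 0 1 / T 1 1 := by
      rw [← coe_re, hcoe]; simp only [Complex.add_re, Complex.re_ofReal_mul, Complex.ofReal_re]; rfl
    rw [this]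
    refine (abs_add_le _ _).trans (add_le_add_left ?_ _)
    rw [abs_mul, abs_of_pos ha]
    exact mul_le_mul_of_nonneg_left hz ha.le
  · have : (T • z : ℍ).im = (T 0 0 / T 1 1) * z.im := by
      rw [← coe_im, hcoe]; simp only [Complex.add_im, Complex.im_ofReal_mul, Complex.ofReal_im, add_zero]; rfl
    rw [this]
    rwa [div_le_iff₀' ha] at hz'

lemma exists_toGL_smul_infty (c : OnePoint ℝ) : ∃ g : SL(2, ℝ), toGL g • OnePoint.infty = c := by
  obtain ⟨g, hg⟩ := OnePoint.exists_mem_SL2 ℝ c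
  refine ⟨g, ?_⟩
  have : toGL g = Matrix.SpecialLinearGroup.mapGL ℝ g := by ext; simp
  rw [this]; exact hg

/-- To have a limit at a cusp, it suffices to have one in a single parametrization. -/
lemma tendsto_extNhds_cusp_of_strip {Γ : Subgroup SL(2, ℝ)} {c : OnePoint ℝ} {hc : IsCuspOf Γ c}
    {α : Type*} {F : ℍ → α} {l : Filter α} {g : SL(2, ℝ)} (hg : toGL g • OnePoint.infty = c)
    (h : ∀ M, Tendsto (fun z => F (g • z)) (stripFilter M) l) :
    Tendsto F (extNhds (.cusp c hc)) l := by
  rw [tendsto_extNhds_cusp]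
  intro g' hg' M
  -- g⁻¹g' fixes ∞, hence is upper triangular.
  have hT : (g⁻¹ * g') 1 0 = 0 := by
    have : toGL (g⁻¹ * g') • (OnePoint.infty : OnePoint ℝ) = OnePoint.infty := by
      rw [map_mul, mul_smul, hg', map_inv, inv_smul_eq_iff, hg]
    exact OnePoint.smul_infty_eq_self_iff.1 this
  obtain ⟨M', hM'⟩ := tendsto_stripFilter_of_apply_one_zero hT M
  have := (h M').comp hM'
  simpa only [Function.comp_def, smul_smul, mul_inv_cancel_left] using this

/-! ## Decay at the cusps -/

/-- The exponents are real of unknown sign: the bound on a serves s ≥ 0, the one on a⁻¹ serves s ≤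
0. -/
lemma rpow_le_rpow_abs {a X : ℝ} (s : ℝ) (ha : 0 < a) (h : a ≤ X) (h' : a⁻¹ ≤ X) :
    a ^ s ≤ X ^ |s| := by
  rcases le_total 0 s with hs | hs
  · rw [abs_of_nonneg hs]
    exact Real.rpow_le_rpow ha.le h hs
  · rw [abs_of_nonpos hs, show s = -(-s) by ring, Real.rpow_neg ha.le, ← Real.inv_rpow ha.le,
      neg_neg]
    exact Real.rpow_le_rpow (inv_pos.2 ha).le h' (by linarith)

/-- In a strip |z| is at most a multiple of Im z, so everything affine in z is too. The inverses are
controlled because the denominator stays away from 0: its absolute value is |d| if c = 0, and at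
least |c| Im z otherwise. -/
lemma exists_denom_bound (g : SL(2, ℝ)) (M : ℝ) : ∃ K : ℝ, 1 ≤ K ∧ ∀ z : ℍ, |z.re| ≤ M →
    1 ≤ z.im → ‖denom (toGL g) z‖ ≤ K * z.im ∧ ‖denom (toGL g) z‖⁻¹ ≤ K * z.im ∧
      1 + ‖((g • z : ℍ) : ℂ)‖ ≤ K * z.im := by
  have hnorm : ∀ z : ℍ, |z.re| ≤ M → 1 ≤ z.im → ‖(z : ℂ)‖ ≤ (|M| + 1) * z.im := by
    intro z hz hz1
    have h1 := Complex.norm_le_abs_re_add_abs_im (z : ℂ)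
    rw [coe_re, coe_im, abs_of_pos z.im_pos] at h1
    have h2 : |M| * 1 ≤ |M| * z.im := mul_le_mul_of_nonneg_left hz1 (abs_nonneg _)
    have := le_abs_self M
    nlinarith
  obtain ⟨m, hm, hmle⟩ : ∃ m : ℝ, 0 < m ∧ ∀ z : ℍ, 1 ≤ z.im → m ≤ ‖denom (toGL g) z‖ := by
    by_cases hc : g 1 0 = 0
    · have hdet := sl_det g
      rw [hc, mul_zero, sub_zero] at hdet
      refine ⟨|g 1 1|, abs_pos.2 (right_ne_zero_of_mul_eq_one hdet), fun z _ => ?_⟩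
      rw [denom_toGL, hc]; simp
    · refine ⟨|g 1 0|, abs_pos.2 hc, fun z hz => ?_⟩
      have h1 := Complex.abs_im_le_norm (denom (toGL g) z)
      rw [denom_toGL] at h1 ⊢
      simp only [Complex.add_im, Complex.im_ofReal_mul, Complex.ofReal_im, add_zero, abs_mul,
        coe_im, abs_of_pos z.im_pos] at h1
      have := mul_le_mul_of_nonneg_left hz (abs_nonneg (g 1 0))
      linarith
  set K1 : ℝ := |g 1 0| * (|M| + 1) + |g 1 1|
  set K2 : ℝ := (|g 0 0| * (|M| + 1) + |g 0 1|) * m⁻¹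
  have hlin : ∀ (a b : ℝ) (z : ℍ), |z.re| ≤ M → 1 ≤ z.im →
      ‖(a : ℂ) * z + b‖ ≤ (|a| * (|M| + 1) + |b|) * z.im := by
    intro a b z hz hz1
    have h1 := norm_add_le ((a : ℂ) * z) b
    rw [norm_mul, Complex.norm_real, Complex.norm_real, Real.norm_eq_abs, Real.norm_eq_abs] at h1
    have h2 := mul_le_mul_of_nonneg_left (hnorm z hz hz1) (abs_nonneg a)
    have h3 := mul_le_mul_of_nonneg_left hz1 (abs_nonneg b)
    linarith
  have hK1 : 0 ≤ K1 := by positivity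
  have hK2 : 0 ≤ K2 := by positivity
  have hmi : 0 < m⁻¹ := inv_pos.2 hm
  refine ⟨K1 + m⁻¹ + K2 + 1, by linarith, fun z hz hz1 => ⟨?_, ?_, ?_⟩⟩
  · rw [denom_toGL]
    refine (hlin _ _ z hz hz1).trans (mul_le_mul_of_nonneg_right ?_ z.im_pos.le)
    change K1 ≤ _
    linarith
  · refine (inv_anti₀ hm (hmle z hz1)).trans ?_
    nlinarith
  · have h2 : ‖((g • z : ℍ) : ℂ)‖ ≤ K2 * z.im := by
      rw [coe_sl_smul, norm_div, div_eq_mul_inv]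
      have h3 := hlin (g 0 0) (g 0 1) z hz hz1
      have h4 := inv_anti₀ hm (hmle z hz1)
      calc _ ≤ (|g 0 0| * (|M| + 1) + |g 0 1|) * z.im * m⁻¹ :=
            mul_le_mul h3 h4 (by positivity) (by have := z.im_pos; positivity)
        _ = K2 * z.im := by simp only [K2]; ring
    nlinarith

/-- In a strip at a cusp, the form `f(τ) dτ` decays exponentially, even after multiplication by
a power of `1 + |τ|`. -/
lemma HasCuspDecay.exists_bound {Γ : Subgroup SL(2, ℝ)} {k : ℝ} {f : ℍ → ℂ}
    (hf : HasCuspDecay Γ k f) {g : SL(2, ℝ)} (hg : IsCuspOf Γ (toGL g • OnePoint.infty))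
    {a : ℝ} (ha : 0 ≤ a) (M : ℝ) : ∃ ε C Y : ℝ, 0 < ε ∧ 0 ≤ C ∧ 1 ≤ Y ∧
      ∀ z : ℍ, |z.re| ≤ M → Y ≤ z.im →
        ‖f (g • z)‖ * (1 + ‖((g • z : ℍ) : ℂ)‖) ^ a * ‖1 / denom (toGL g) z ^ 2‖ ≤
          C * Real.exp (-ε * z.im) := by
  obtain ⟨ε, hε, h⟩ := hf g hg
  obtain ⟨C, hC, h⟩ := h.exists_pos
  rw [Asymptotics.IsBigOWith, Filter.Eventually, atImInfty_mem] at h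
  obtain ⟨Y₁, h⟩ := h
  obtain ⟨K, hK, hKle⟩ := exists_denom_bound g M
  -- `HasCuspDecay` supplies the factor |cz+d|^(-k), while dτ requires |cz+d|^(-2). The discrepancy
  -- and the weight (1+|τ|)^a cost the power s of Im z, absorbed by giving up half of ε.
  set s := |k - 2| + a
  have hlo := (isLittleO_rpow_exp_pos_mul_atTop s (half_pos hε)).bound one_pos
  obtain ⟨Y₂, hY₂⟩ := eventually_atTop.1 hlo
  refine ⟨ε / 2, C * K ^ s, max (max Y₁ Y₂) 1, half_pos hε, by positivity, le_max_right _ _,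
    fun z hz hzY => ?_⟩
  have hz1 : 1 ≤ z.im := (le_max_right _ _).trans hzY
  have hd := norm_pos_iff.2 (denom_ne_zero (toGL g) z)
  obtain ⟨h1, h2, h3⟩ := hKle z hz hz1
  have h4 := h z (((le_max_left _ _).trans (le_max_left _ _)).trans hzY)
  have h5 := hY₂ z.im (((le_max_right _ _).trans (le_max_left _ _)).trans hzY)
  simp only [mem_ofPred_eq, Real.norm_eq_abs, Real.abs_exp] at h4
  rw [abs_of_nonneg (by positivity)] at h4
  rw [Real.norm_of_nonneg (by positivity), Real.norm_of_nonneg (by positivity), one_mul] at h5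
  set D := ‖denom (toGL g) z‖
  have hKz : 0 < K * z.im := by positivity
  have h6 : ‖1 / denom (toGL g) z ^ 2‖ = D ^ (-k) * D ^ (k - 2) := by
    rw [← Real.rpow_add hd, norm_div, norm_one, norm_pow, show -k + (k - 2) = -(2 : ℕ) by
      push_cast; ring, Real.rpow_neg hd.le, Real.rpow_natCast, one_div]
  have h7 : D ^ (k - 2) ≤ (K * z.im) ^ |k - 2| := rpow_le_rpow_abs _ hd h1 h2
  have h8 : (1 + ‖((g • z : ℍ) : ℂ)‖) ^ a ≤ (K * z.im) ^ a :=
    Real.rpow_le_rpow (by positivity) h3 ha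
  calc _ = (D ^ (-k) * ‖f (g • z)‖) * (D ^ (k - 2) * (1 + ‖((g • z : ℍ) : ℂ)‖) ^ a) := by
        rw [h6]; ring
    _ ≤ (C * Real.exp (-ε * z.im)) * ((K * z.im) ^ |k - 2| * (K * z.im) ^ a) := by gcongr
    _ = C * K ^ s * (z.im ^ s * Real.exp (-ε * z.im)) := by
        rw [← Real.rpow_add hKz, Real.mul_rpow (by positivity) z.im_pos.le]; ring
    _ ≤ C * K ^ s * (Real.exp (ε / 2 * z.im) * Real.exp (-ε * z.im)) := by gcongr
    _ = _ := by rw [← Real.exp_add]; ring_nf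

/-! ## Admissible paths near their end points -/

lemma Filter.Tendsto.stripFilter_of_im {α : Type*} {l : Filter α} {q : α → ℍ} {M : ℝ}
    (h : Tendsto (fun a => (q a).im) l atTop) (hre : ∀ᶠ a in l, |(q a).re| ≤ M) :
    Tendsto q l (stripFilter M) :=
  tendsto_inf.2 ⟨tendsto_comap_iff.2 h, tendsto_principal.2 hre⟩

lemma im_ofComplex_I_mul {u : ℝ} (hu : 0 < u) : (ofComplex (Complex.I * u)).im = u := by
  rw [ofComplex_apply_of_im_pos (by simpa using hu), ← coe_im]; simp

lemma re_ofComplex_I_mul {u : ℝ} (hu : 0 < u) : (ofComplex (Complex.I * u)).re = 0 := by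
  rw [ofComplex_apply_of_im_pos (by simpa using hu), ← coe_re]; simp

lemma coe_ofComplex_I_mul {u : ℝ} (hu : 0 < u) :
    ((ofComplex (Complex.I * u) : ℍ) : ℂ) = Complex.I * u := by
  rw [ofComplex_apply_of_im_pos (by simpa using hu)]

/-- At a cusp the path is g(iu) with u → ∞, so it stays in the strip of width 0. -/
lemma StartsAt.tendsto {Γ : Subgroup SL(2, ℝ)} {p : ℝ → ℍ} {x : ExtUHP Γ} (h : StartsAt p x) :
    Tendsto p (𝓝[>] 0) (extNhds x) := by
  cases x with
  | point z =>
    obtain ⟨h0, h1⟩ := h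
    have h2 : ContinuousWithinAt p (Ici 0) 0 :=
      isOpenEmbedding_coe.isEmbedding.isInducing.continuousWithinAt_iff.2 h1.continuousWithinAt
    have h3 := h2.tendsto.mono_left (nhdsWithin_mono 0 Ioi_subset_Ici_self)
    rwa [h0] at h3
  | cusp c hc =>
    obtain ⟨g, hg, u, δ, hδ, -, hu, hp⟩ := h
    have key := tendsto_extNhds_cusp.1 (tendsto_id (x := extNhds (.cusp c hc))) g hg 0
    have hev : ∀ᶠ s in 𝓝[>] (0 : ℝ), s ∈ Ioo 0 δ := Ioo_mem_nhdsGT hδ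
    have h1 : Tendsto (fun s => ofComplex (Complex.I * u s)) (𝓝[>] 0) (stripFilter 0) := by
      refine Tendsto.stripFilter_of_im (hu.congr' ?_) ?_
      · filter_upwards [hev] with s hs
        rw [im_ofComplex_I_mul (hp s hs).1]
      · filter_upwards [hev] with s hs
        rw [re_ofComplex_I_mul (hp s hs).1, abs_zero]
    refine (key.comp h1).congr' ?_
    filter_upwards [hev] with s hs
    simp [(hp s hs).2]

/-- Limits at points of ℍ* are unique because some admissible path runs into each of them. -/
instance extNhds_neBot {Γ : Subgroup SL(2, ℝ)} (x : ExtUHP Γ) : (extNhds x).NeBot :=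
  (isPathFromTo_stdPath x x).startsAt.tendsto.neBot

lemma IsPathFromTo.reverse {Γ : Subgroup SL(2, ℝ)} {p : ℝ → ℍ} {x y : ExtUHP Γ}
    (hp : IsPathFromTo p x y) : IsPathFromTo (fun s => p (1 - s)) y x where
  contDiffOn := hp.contDiffOn.comp (f := fun s : ℝ => 1 - s) (by fun_prop)
    fun s hs => ⟨by linarith [hs.2], by linarith [hs.1]⟩
  startsAt := hp.endsAt
  endsAt := by simpa using hp.startsAt

lemma IsPathFromTo.tendsto_end {Γ : Subgroup SL(2, ℝ)} {p : ℝ → ℍ} {x y : ExtUHP Γ}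
    (hp : IsPathFromTo p x y) : Tendsto p (𝓝[<] 1) (extNhds y) := by
  have h1 : Tendsto (fun s : ℝ => 1 - s) (𝓝[<] 1) (𝓝[>] 0) := by
    refine tendsto_nhdsWithin_iff.2 ⟨?_, ?_⟩
    · have : Tendsto (fun s : ℝ => 1 - s) (𝓝 1) (𝓝 (1 - 1)) := (continuous_const.sub continuous_id).tendsto 1
      rw [sub_self] at this
      exact this.mono_left nhdsWithin_le_nhds
    · filter_upwards [self_mem_nhdsWithin] with s hs
      exact sub_pos.2 (mem_Iio.1 hs)
  simpa [Function.comp_def] using hp.endsAt.tendsto.comp h1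

lemma IsPathFromTo.continuousOn {Γ : Subgroup SL(2, ℝ)} {p : ℝ → ℍ} {x y : ExtUHP Γ}
    (hp : IsPathFromTo p x y) : ContinuousOn p (Ioo 0 1) :=
  isOpenEmbedding_coe.isEmbedding.isInducing.continuousOn_iff.2 hp.contDiffOn.continuousOn

lemma IsPathFromTo.hasDerivAt {Γ : Subgroup SL(2, ℝ)} {p : ℝ → ℍ} {x y : ExtUHP Γ}
    (hp : IsPathFromTo p x y) {s : ℝ} (hs : s ∈ Ioo (0 : ℝ) 1) :
    HasDerivAt (fun r => (p r : ℂ)) (deriv (fun r => (p r : ℂ)) s) s :=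
  ((hp.contDiffOn.differentiableOn one_ne_zero).differentiableAt
    (isOpen_Ioo.mem_nhds hs)).hasDerivAt

/-! ## Integrability along admissible paths -/

/-- Holomorphic functions on `ℍ` decaying exponentially at the cusps of `Γ`, in some weight. -/
structure IsCuspidal (Γ : Subgroup SL(2, ℝ)) (f : ℍ → ℂ) : Prop where
  mdifferentiable : MDiff f
  decay : ∃ k, HasCuspDecay Γ k f

/-- The density `|f(τ)| (1 + |τ|) ^ a |dτ|` along the path `p`. -/
noncomputable def pathMajorant (p : ℝ → ℍ) (f : ℍ → ℂ) (a : ℝ) (s : ℝ) : ℝ :=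
  ‖f (p s)‖ * (1 + ‖(p s : ℂ)‖) ^ a * ‖deriv (fun r => (p r : ℂ)) s‖

lemma pathMajorant_nonneg (p : ℝ → ℍ) (f : ℍ → ℂ) (a s : ℝ) : 0 ≤ pathMajorant p f a s := by
  unfold pathMajorant; positivity

lemma pathMajorant_reverse (p : ℝ → ℍ) (f : ℍ → ℂ) (a s : ℝ) :
    pathMajorant (fun r => p (1 - r)) f a s = pathMajorant p f a (1 - s) := by
  simp only [pathMajorant]
  rw [deriv_comp_const_sub (fun r => (p r : ℂ)), norm_neg]

lemma continuousOn_pathMajorant {Γ : Subgroup SL(2, ℝ)} {p : ℝ → ℍ} {x y : ExtUHP Γ}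
    (hp : IsPathFromTo p x y) {f : ℍ → ℂ} (hf : Continuous f) (a : ℝ) :
    ContinuousOn (pathMajorant p f a) (Ioo 0 1) := by
  have h1 := hp.contDiffOn.continuousOn
  have h2 := hp.contDiffOn.continuousOn_deriv_of_isOpen isOpen_Ioo le_rfl
  refine ((hf.comp_continuousOn hp.continuousOn).norm.mul
    ((continuousOn_const.add h1.norm).rpow_const fun s _ => Or.inl ?_)).mul h2.norm
  exact (add_pos_of_pos_of_nonneg one_pos (norm_nonneg _)).ne'

/-- Being C¹ up to the end point, the path has a one-sided derivative continuous on a compact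
interval, and this agrees with the derivative away from the end point. -/
lemma integrableOn_pathMajorant_point {Γ : Subgroup SL(2, ℝ)} {p : ℝ → ℍ} {z : ℍ}
    (hp : StartsAt (Γ := Γ) p (.point z)) {f : ℍ → ℂ} (hf : Continuous f) (a : ℝ) :
    ∃ δ ∈ Ioo (0 : ℝ) 1, IntegrableOn (pathMajorant p f a) (Ioc 0 δ) := by
  obtain ⟨u, hu, -, hC⟩ := hp.2.contDiffOn le_rfl (by simp)
  rw [insert_eq_of_mem self_mem_Ici] at hu
  obtain ⟨δ, hδ, hsub⟩ := mem_nhdsGE_iff_exists_Icc_subset.1 hu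
  have hδ0 : (0 : ℝ) < δ := hδ
  have hC := hC.mono hsub
  have hder := hC.continuousOn_derivWithin (uniqueDiffOn_Icc hδ0) le_rfl
  have hpc : ContinuousOn p (Icc 0 δ) :=
    isOpenEmbedding_coe.isEmbedding.isInducing.continuousOn_iff.2 hC.continuousOn
  have hcont : ContinuousOn (fun s => ‖f (p s)‖ * (1 + ‖(p s : ℂ)‖) ^ a *
      ‖derivWithin (fun r => (p r : ℂ)) (Icc 0 δ) s‖) (Icc 0 δ) := by
    refine ((hf.comp_continuousOn hpc).norm.mul
      ((continuousOn_const.add hC.continuousOn.norm).rpow_const fun s _ => Or.inl ?_)).mul hder.norm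
    exact (add_pos_of_pos_of_nonneg one_pos (norm_nonneg _)).ne'
  refine ⟨min (δ / 2) (1 / 2), ⟨by positivity, (min_le_right _ _).trans_lt (by norm_num)⟩, ?_⟩
  have hlt : min (δ / 2) (1 / 2) < δ := (min_le_left _ _).trans_lt (half_lt_self hδ0)
  refine ((hcont.integrableOn_compact isCompact_Icc).mono_set
    (fun s hs => ⟨hs.1.le, hs.2.trans hlt.le⟩)).congr_fun (fun s hs => ?_) measurableSet_Ioc
  simp only [pathMajorant]
  rw [derivWithin_of_mem_nhds (Icc_mem_nhds hs.1 (hs.2.trans_lt hlt))]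

lemma deriv_nonpos_of_antitoneOn {u : ℝ → ℝ} {S : Set ℝ} (hS : IsOpen S) (hu : AntitoneOn u S)
    {s : ℝ} (hs : s ∈ S) : deriv u s ≤ 0 := by
  rw [← derivWithin_of_isOpen hS hs]
  exact hu.derivWithin_nonpos

/-- Along τ = g(iu) the majorant is at most C exp(-εu)(-u'), because u' ≤ 0. This is C/ε times the
derivative of exp(-εu), which increases from its limit 0 at the cusp. Monotonicity thus replaces any
bound on u'. -/
lemma integrableOn_pathMajorant_cusp {Γ : Subgroup SL(2, ℝ)} {p : ℝ → ℍ} {c : OnePoint ℝ}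
    {hc : IsCuspOf Γ c} {y : ExtUHP Γ} (hp : IsPathFromTo p (.cusp c hc) y) {f : ℍ → ℂ}
    (hf : IsCuspidal Γ f) {a : ℝ} (ha : 0 ≤ a) :
    ∃ δ ∈ Ioo (0 : ℝ) 1, IntegrableOn (pathMajorant p f a) (Ioc 0 δ) := by
  obtain ⟨g, hg, u, δ₀, hδ₀, hanti, hu, hpu⟩ := hp.startsAt
  obtain ⟨k, hk⟩ := hf.decay
  obtain ⟨ε, C, Y, hε, hC, hY, hbound⟩ := hk.exists_bound (g := g) (by rwa [hg]) ha 0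
  have hev : ∀ᶠ s in 𝓝[>] (0 : ℝ), s ∈ Ioo (0 : ℝ) δ₀ ∧ s ∈ Ioo (0 : ℝ) 1 ∧ Y ≤ u s :=
    (eventually_of_mem (Ioo_mem_nhdsGT hδ₀) fun _ h => h).and
      ((eventually_of_mem (Ioo_mem_nhdsGT one_pos) fun _ h => h).and (hu.eventually_ge_atTop Y))
  obtain ⟨δ, hδ, hsub⟩ := mem_nhdsGT_iff_exists_Ioo_subset.1 hev
  have hδ : (0 : ℝ) < δ := hδ
  have hsub : ∀ s ∈ Ioo 0 δ, s ∈ Ioo (0 : ℝ) δ₀ ∧ s ∈ Ioo (0 : ℝ) 1 ∧ Y ≤ u s := hsub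
  -- `u` is differentiable and its derivative determines that of `p`
  have hdu : ∀ s ∈ Ioo 0 δ, HasDerivAt u (deriv u s) s := by
    intro s hs
    refine DifferentiableAt.hasDerivAt ?_
    -- Smoothness of u is not part of `StartsAt`; it is inherited from p through u = Im(g⁻¹p).
    have h1 := (hasDerivAt_sl_smul g⁻¹ (p s)).differentiableAt.restrictScalars ℝ
    have h2 := (hp.hasDerivAt (hsub s hs).2.1).differentiableAt
    have h3 : DifferentiableAt ℝ
        (fun r => Complex.imCLM (((g⁻¹ • ofComplex (p r : ℂ) : ℍ) : ℂ))) s :=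
      Complex.imCLM.differentiableAt.comp s (DifferentiableAt.comp (f := fun r => (p r : ℂ))
        (g := fun w : ℂ => ((g⁻¹ • ofComplex w : ℍ) : ℂ)) s h1 h2)
    refine h3.congr_of_eventuallyEq ?_
    filter_upwards [isOpen_Ioo.mem_nhds hs] with r hr
    obtain ⟨h4, h5⟩ := hpu r (hsub r hr).1
    rw [ofComplex_apply, h5, inv_smul_smul, Complex.imCLM_apply, coe_im, im_ofComplex_I_mul h4]
  have hdp : ∀ s ∈ Ioo 0 δ, deriv (fun r => (p r : ℂ)) s =
      1 / denom (toGL g) (ofComplex (Complex.I * u s)) ^ 2 * (Complex.I * deriv u s) := by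
    intro s hs
    have h1 := hasDerivAt_sl_smul g (ofComplex (Complex.I * u s))
    rw [coe_ofComplex_I_mul (hpu s (hsub s hs).1).1] at h1
    have h2 : HasDerivAt (fun r => Complex.I * (u r : ℂ)) (Complex.I * deriv u s) s :=
      ((hdu s hs).ofReal_comp).const_mul _
    have h3 := HasDerivAt.comp s h1 h2
    rw [coe_ofComplex_I_mul (hpu s (hsub s hs).1).1]
    refine HasDerivAt.deriv (h3.congr_of_eventuallyEq ?_)
    filter_upwards [isOpen_Ioo.mem_nhds hs] with r hr
    simp only [Function.comp_apply]
    rw [(hpu r (hsub r hr).1).2]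
  have hdn : ∀ s ∈ Ioo 0 δ, deriv u s ≤ 0 := fun s hs =>
    deriv_nonpos_of_antitoneOn isOpen_Ioo hanti (hsub s hs).1
  -- the primitive of the majorant
  set v : ℝ → ℝ := fun s => if s ≤ 0 then 0 else Real.exp (-ε * u s)
  have hveq : ∀ s, 0 < s → v =ᶠ[𝓝 s] fun s => Real.exp (-ε * u s) := by
    intro s hs
    filter_upwards [Ioi_mem_nhds hs] with r hr
    simp only [v, if_neg (not_le.2 (mem_Ioi.1 hr))]
  have hdv : ∀ s ∈ Ioo 0 δ, HasDerivAt v (Real.exp (-ε * u s) * (-ε * deriv u s)) s :=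
    fun s hs => (((hdu s hs).const_mul (-ε)).exp).congr_of_eventuallyEq (hveq s hs.1)
  -- At 0 this uses u → ∞: the value 0 assigned to v there is the limit of exp(-εu).
  have hvc : ContinuousOn v (Icc 0 (δ / 2)) := by
    intro s hs
    rcases hs.1.eq_or_lt with h0 | h0
    · subst h0
      rw [← continuousWithinAt_sdiff_self]
      have hlim : Tendsto (fun s => Real.exp (-ε * u s)) (𝓝[>] 0) (𝓝 0) := by
        refine Real.tendsto_exp_atBot.comp ?_
        exact hu.const_mul_atTop_of_neg (by linarith)
      have : v 0 = 0 := by simp [v]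
      rw [ContinuousWithinAt, this]
      have h1 : 𝓝[Icc 0 (δ / 2) \ {0}] (0 : ℝ) ≤ 𝓝[>] 0 :=
        nhdsWithin_mono _ fun r hr => lt_of_le_of_ne hr.1.1 (Ne.symm hr.2)
      refine (hlim.mono_left h1).congr' ?_
      filter_upwards [h1 self_mem_nhdsWithin] with r hr
      simp only [v, if_neg (not_le.2 (mem_Ioi.1 hr))]
    · exact (hdv s ⟨h0, hs.2.trans_lt (half_lt_self hδ)⟩).continuousAt.continuousWithinAt
  -- A nonnegative derivative of a function continuous up to the boundary is integrable.
  have hint := intervalIntegral.integrableOn_deriv_of_nonneg hvc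
    (fun s hs => hdv s ⟨hs.1, hs.2.trans (half_lt_self hδ)⟩) (fun s hs => by
      have := hdn s ⟨hs.1, hs.2.trans (half_lt_self hδ)⟩
      exact mul_nonneg (Real.exp_pos _).le (by nlinarith))
  have hmem : ∀ s ∈ Ioc 0 (δ / 2), s ∈ Ioo 0 δ :=
    fun s hs => ⟨hs.1, hs.2.trans_lt (half_lt_self hδ)⟩
  refine ⟨δ / 2, (hsub _ ⟨half_pos hδ, half_lt_self hδ⟩).2.1, ?_⟩
  refine (hint.const_mul (C / ε)).mono' ?_ ?_
  · exact ((continuousOn_pathMajorant hp hf.mdifferentiable.continuous a).mono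
      fun s hs => (hsub s (hmem s hs)).2.1).aestronglyMeasurable measurableSet_Ioc
  · refine (ae_restrict_iff' measurableSet_Ioc).2 (Eventually.of_forall fun s hs => ?_)
    have hs := hmem s hs
    obtain ⟨hs1, -, hs3⟩ := hsub s hs
    have hpos := (hpu s hs1).1
    have h1 := hbound (ofComplex (Complex.I * u s)) (by rw [re_ofComplex_I_mul hpos, abs_zero])
      (by rwa [im_ofComplex_I_mul hpos])
    rw [← (hpu s hs1).2, im_ofComplex_I_mul hpos] at h1
    rw [Real.norm_of_nonneg (pathMajorant_nonneg _ _ _ _), pathMajorant, hdp s hs, norm_mul,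
      norm_mul, Complex.norm_I, one_mul, Complex.norm_real, Real.norm_eq_abs,
      abs_of_nonpos (hdn s hs), ← mul_assoc]
    refine (mul_le_mul_of_nonneg_right h1 (neg_nonneg.2 (hdn s hs))).trans (le_of_eq ?_)
    field_simp

/-- Each end is handled as a starting point, the second one after reversing the path; the compact
middle piece is harmless by continuity. -/
lemma integrableOn_pathMajorant {Γ : Subgroup SL(2, ℝ)} {p : ℝ → ℍ} {x y : ExtUHP Γ}
    (hp : IsPathFromTo p x y) {f : ℍ → ℂ} (hf : IsCuspidal Γ f) {a : ℝ} (ha : 0 ≤ a) :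
    IntervalIntegrable (pathMajorant p f a) volume 0 1 := by
  have key : ∀ {x y : ExtUHP Γ} {p : ℝ → ℍ}, IsPathFromTo p x y →
      ∃ δ ∈ Ioo (0 : ℝ) 1, IntervalIntegrable (pathMajorant p f a) volume 0 δ := by
    intro x y p hp
    have : ∃ δ ∈ Ioo (0 : ℝ) 1, IntegrableOn (pathMajorant p f a) (Ioc 0 δ) := by
      cases x with
      | point z => exact integrableOn_pathMajorant_point hp.startsAt hf.mdifferentiable.continuous a
      | cusp c hc => exact integrableOn_pathMajorant_cusp hp hf ha
    obtain ⟨δ, hδ, h⟩ := this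
    exact ⟨δ, hδ, (intervalIntegrable_iff_integrableOn_Ioc_of_le hδ.1.le).2 h⟩
  obtain ⟨δ, hδ, h1⟩ := key hp
  obtain ⟨δ', hδ', h2⟩ := key hp.reverse
  have h3 := h2.comp_sub_left 1
  simp only [pathMajorant_reverse, sub_sub_cancel, sub_zero] at h3
  refine h1.trans (IntervalIntegrable.trans (b := 1 - δ') ?_ h3.symm)
  refine ContinuousOn.intervalIntegrable
    ((continuousOn_pathMajorant hp hf.mdifferentiable.continuous a).mono ?_)
  intro s hs
  rw [mem_uIcc] at hs
  have := hδ.1; have := hδ.2; have := hδ'.1; have := hδ'.2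
  constructor <;> rcases hs with hs | hs <;> linarith [hs.1, hs.2]

/-! ## Convergence and growth of iterated integrals -/

/-- `1 + |t| + 1 / |Im t|`, whose powers measure polynomial growth on the lower half-plane. -/
noncomputable def lhpSize (t : ℂ) : ℝ := 1 + ‖t‖ + |t.im|⁻¹

lemma one_le_lhpSize (t : ℂ) : 1 ≤ lhpSize t := by
  unfold lhpSize; have := norm_nonneg t; have := inv_nonneg.2 (abs_nonneg t.im); linarith

/-- This separates τ from t. From above |τ-t| ≤ |τ|+|t|; from below |τ-t| ≥ |Im t|, because Im τ and
Im t have opposite signs. Both bounds are needed as w may have either sign. -/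
lemma norm_sub_cpow_le (z : ℍ) {t : ℂ} (ht : t.im < 0) (w : ℝ) :
    ‖((z : ℂ) - t) ^ (w : ℂ)‖ ≤ (1 + ‖(z : ℂ)‖) ^ |w| * lhpSize t ^ |w| := by
  have him : ((z : ℂ) - t).im = z.im - t.im := by simp
  have hne : (z : ℂ) - t ≠ 0 := fun h => by
    rw [h, Complex.zero_im] at him; linarith [z.im_pos]
  have h1 := one_le_lhpSize t
  have h2 : 0 ≤ ‖(z : ℂ)‖ := norm_nonneg _
  have h3 : 0 ≤ ‖t‖ := norm_nonneg _
  have h4 : 0 < |t.im|⁻¹ := inv_pos.2 (abs_pos.2 ht.ne)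
  have hsz : ‖t‖ ≤ lhpSize t := by unfold lhpSize; linarith
  have hsz' : |t.im|⁻¹ ≤ lhpSize t := by unfold lhpSize; linarith
  rw [Complex.norm_cpow_real, ← Real.mul_rpow (by positivity) (by linarith)]
  refine rpow_le_rpow_abs w (norm_pos_iff.2 hne) ?_ ?_
  · refine (norm_sub_le _ _).trans ?_
    unfold lhpSize
    nlinarith [mul_nonneg h2 h4.le, mul_nonneg h2 h3]
  · have h5 : |t.im| ≤ ‖(z : ℂ) - t‖ := by
      refine le_trans ?_ (Complex.abs_im_le_norm _)
      rw [him, abs_of_neg ht, abs_of_pos (by linarith [z.im_pos])]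
      linarith [z.im_pos]
    refine (inv_anti₀ (abs_pos.2 ht.ne) h5).trans (hsz'.trans ?_)
    nlinarith

lemma norm_pathIntegrand_le (p : ℝ → ℍ) (t : LHP) (f : ℍ → ℂ) (w : ℝ) (F : ℝ → ℂ) (s : ℝ) :
    ‖pathIntegrand p t f w F s‖ ≤ pathMajorant p f |w| s * lhpSize t.1 ^ |w| * ‖F s‖ := by
  rw [pathIntegrand, pathMajorant, norm_mul, norm_mul, norm_mul]
  calc _ ≤ ‖f (p s)‖ * ((1 + ‖(p s : ℂ)‖) ^ |w| * lhpSize t.1 ^ |w|) * ‖F s‖ *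
        ‖deriv (fun r => (p r : ℂ)) s‖ := by
        gcongr
        exact norm_sub_cpow_le _ t.2 _
    _ = _ := by ring

lemma continuousOn_pathIntegrand {Γ : Subgroup SL(2, ℝ)} {p : ℝ → ℍ} {x y : ExtUHP Γ}
    (hp : IsPathFromTo p x y) (t : LHP) {f : ℍ → ℂ} (hf : Continuous f) (w : ℝ) {F : ℝ → ℂ}
    (hF : ContinuousOn F (Ioo 0 1)) : ContinuousOn (pathIntegrand p t f w F) (Ioo 0 1) := by
  have h1 := hp.contDiffOn.continuousOn
  have h2 := hp.contDiffOn.continuousOn_deriv_of_isOpen isOpen_Ioo le_rfl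
  refine (((hf.comp_continuousOn hp.continuousOn).mul
    ((h1.sub continuousOn_const).cpow_const fun s _ => ?_)).mul hF).mul h2
  refine Or.inr (ne_of_gt ?_)
  have := t.2
  have him : ((p s : ℂ) - t.1).im = (p s).im - t.1.im := by simp
  change 0 < ((p s : ℂ) - t.1).im
  rw [him]
  linarith [(p s).im_pos]

/-- Iterated integrals along an admissible path converge absolutely, are continuous in the upper
limit, and have polynomial growth in `t`, uniformly in the upper limit. -/
theorem exists_bound_iterInt {Γ : Subgroup SL(2, ℝ)} {p : ℝ → ℍ} {x y : ExtUHP Γ}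
    (hp : IsPathFromTo p x y) (L : List ((ℍ → ℂ) × ℝ)) (hL : ∀ e ∈ L, IsCuspidal Γ e.1) :
    ∃ C a : ℝ, 0 ≤ C ∧ 0 ≤ a ∧ ∀ t : LHP, IterConverges p t L ∧
      ContinuousOn (iterInt p t L) (Icc 0 1) ∧
      ∀ s ∈ Icc (0 : ℝ) 1, ‖iterInt p t L s‖ ≤ C * lhpSize t.1 ^ a := by
  induction L with
  | nil => exact ⟨1, 0, zero_le_one, le_rfl, fun t => ⟨trivial, continuousOn_const, by simp [iterInt]⟩⟩
  | cons e L ih =>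
    obtain ⟨f, w⟩ := e
    obtain ⟨C, a, hC, ha, ih⟩ := ih fun e he => hL e (List.mem_cons_of_mem _ he)
    have hf : IsCuspidal Γ f := hL (f, w) List.mem_cons_self
    have hmaj := integrableOn_pathMajorant hp hf (abs_nonneg w)
    have hbd : ∀ t : LHP, ∀ s ∈ Icc (0 : ℝ) 1, ‖pathIntegrand p t f w (iterInt p t L) s‖ ≤
        C * lhpSize t.1 ^ (|w| + a) * pathMajorant p f |w| s := by
      intro t s hs
      refine (norm_pathIntegrand_le _ _ _ _ _ _).trans ?_
      have hpos : 0 < lhpSize t.1 := by linarith [one_le_lhpSize t.1]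
      have := pathMajorant_nonneg p f |w| s
      calc _ ≤ pathMajorant p f |w| s * lhpSize t.1 ^ |w| * (C * lhpSize t.1 ^ a) := by
            gcongr; exact (ih t).2.2 s hs
        _ = _ := by rw [Real.rpow_add hpos]; ring
    have hint : ∀ t : LHP, IntervalIntegrable (pathIntegrand p t f w (iterInt p t L)) volume 0 1 := by
      intro t
      rw [intervalIntegrable_iff_integrableOn_Ioo_of_le zero_le_one] at hmaj ⊢
      refine (hmaj.const_mul (C * lhpSize t.1 ^ (|w| + a))).mono' ?_ ?_
      · exact (continuousOn_pathIntegrand hp t hf.mdifferentiable.continuous w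
          ((ih t).2.1.mono Ioo_subset_Icc_self)).aestronglyMeasurable measurableSet_Ioo
      · exact (ae_restrict_iff' measurableSet_Ioo).2
          (Eventually.of_forall fun s hs => hbd t s (Ioo_subset_Icc_self hs))
    -- Each integration multiplies the constant by the total mass of the majorant and raises the
    -- exponent by |w|.
    refine ⟨C * ∫ s in (0 : ℝ)..1, pathMajorant p f |w| s, |w| + a, ?_, by positivity,
      fun t => ⟨⟨hint t, (ih t).1⟩, ?_, fun s hs => ?_⟩⟩
    · exact mul_nonneg hC (intervalIntegral.integral_nonneg zero_le_one
        fun s _ => pathMajorant_nonneg _ _ _ _)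
    · have := intervalIntegral.continuousOn_primitive_interval' (hint t) left_mem_uIcc
      rwa [uIcc_of_le zero_le_one] at this
    · have hsub : uIcc 0 s ⊆ uIcc (0 : ℝ) 1 := by
        rw [uIcc_of_le zero_le_one, uIcc_of_le hs.1]; exact Icc_subset_Icc_right hs.2
      calc ‖iterInt p t ((f, w) :: L) s‖
          ≤ ∫ r in (0 : ℝ)..s, C * lhpSize t.1 ^ (|w| + a) * pathMajorant p f |w| r :=
            intervalIntegral.norm_integral_le_of_norm_le hs.1
              (Eventually.of_forall fun r hr => hbd t r ⟨hr.1.le, hr.2.trans hs.2⟩)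
              ((hmaj.mono_set hsub).const_mul _)
        _ = C * lhpSize t.1 ^ (|w| + a) * ∫ r in (0 : ℝ)..s, pathMajorant p f |w| r := by
            rw [intervalIntegral.integral_const_mul]
        _ ≤ C * lhpSize t.1 ^ (|w| + a) * ∫ r in (0 : ℝ)..1, pathMajorant p f |w| r := by
            have := one_le_lhpSize t.1
            refine mul_le_mul_of_nonneg_left ?_ (by positivity)
            exact intervalIntegral.integral_mono_interval le_rfl hs.1 hs.2
              (Eventually.of_forall fun r => pathMajorant_nonneg _ _ _ _) hmaj
        _ = _ := by ring

/-! ## Primitives on the upper half-plane and their limits in `ℍ*` -/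

lemma tendsto_im_stripFilter (M : ℝ) : Tendsto UpperHalfPlane.im (stripFilter M) atTop :=
  tendsto_comap.mono_left inf_le_left

lemma eventually_abs_re_stripFilter (M : ℝ) : ∀ᶠ z in stripFilter M, |z.re| ≤ M :=
  eventually_stripFilter.2 ⟨0, fun _ h _ => h⟩

/-- A function on `ℍ` whose derivative decays exponentially in vertical strips has a limit. -/
lemma exists_tendsto_stripFilter {H H' : ℍ → ℂ}
    (hH : ∀ z : ℍ, HasDerivAt (H ∘ ofComplex) (H' z) z)
    (hb : ∀ M : ℝ, ∃ ε C Y : ℝ, 0 < ε ∧ ∀ z : ℍ, |z.re| ≤ M → Y ≤ z.im →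
      ‖H' z‖ ≤ C * Real.exp (-ε * z.im)) :
    ∃ a, ∀ M, Tendsto H (stripFilter M) (𝓝 a) := by
  set h : ℝ → ℂ := fun y => (H ∘ ofComplex) (Complex.I * y) with hdef
  obtain ⟨ε, C, Y, hε, hb0⟩ := hb 0
  have hder : ∀ y : ℝ, 0 < y → HasDerivAt h (H' (ofComplex (Complex.I * y)) * Complex.I) y := by
    intro y hy
    have h1 := hH (ofComplex (Complex.I * y))
    rw [coe_ofComplex_I_mul hy] at h1
    have h2 : HasDerivAt (fun r : ℝ => Complex.I * (r : ℂ)) Complex.I y := by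
      simpa using ((hasDerivAt_id y).ofReal_comp).const_mul Complex.I
    exact HasDerivAt.comp y h1 h2
  -- Along the imaginary axis the derivative is integrable at ∞, so the limit exists there.
  have hlim : Tendsto h atTop (𝓝 (limUnder atTop h)) := by
    refine tendsto_limUnder_of_hasDerivAt_of_integrableOn_Ioi (a := max Y 0) (f' := deriv h)
      (fun y hy => ?_) ?_
    · exact (hder y ((le_max_right _ _).trans_lt (mem_Ioi.1 hy))).differentiableAt.hasDerivAt
    · refine ((exp_neg_integrableOn_Ioi (max Y 0) hε).const_mul C).mono'
        (aestronglyMeasurable_deriv h _) ?_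
      refine (ae_restrict_iff' measurableSet_Ioi).2 (Eventually.of_forall fun y hy => ?_)
      have hy0 : 0 < y := (le_max_right _ _).trans_lt (mem_Ioi.1 hy)
      have := hb0 (ofComplex (Complex.I * y)) (by rw [re_ofComplex_I_mul hy0, abs_zero])
        (by rw [im_ofComplex_I_mul hy0]; exact (le_max_left _ _).trans (mem_Ioi.1 hy).le)
      rw [im_ofComplex_I_mul hy0] at this
      rwa [(hder y hy0).deriv, norm_mul, Complex.norm_I, mul_one]
  refine ⟨limUnder atTop h, fun M => ?_⟩
  obtain ⟨ε, C, Y, hε, hbM⟩ := hb M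
  have hexp : Tendsto (fun z : ℍ => C * Real.exp (-ε * z.im) * M) (stripFilter M) (𝓝 0) := by
    have h1 : Tendsto (fun z : ℍ => Real.exp (-ε * z.im)) (stripFilter M) (𝓝 0) :=
      Real.tendsto_exp_atBot.comp
        ((tendsto_im_stripFilter M).const_mul_atTop_of_neg (by linarith))
    simpa using (h1.const_mul C).mul_const M
  -- The point z is joined to i Im z by a horizontal segment of length at most M; there Im is
  -- constant, so the mean value inequality bounds the difference by M C exp(-ε Im z).
  have hdiff : Tendsto (fun z : ℍ => H z - h z.im) (stripFilter M) (𝓝 0) := by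
    refine squeeze_zero_norm' ?_ hexp
    filter_upwards [eventually_abs_re_stripFilter M,
      (tendsto_im_stripFilter M).eventually_ge_atTop Y] with z hz hzY
    have hC : 0 ≤ C * Real.exp (-ε * z.im) := (norm_nonneg _).trans (hbM z hz hzY)
    have hM : 0 ≤ M := (abs_nonneg _).trans hz
    have key := Convex.norm_image_sub_le_of_norm_hasDerivWithin_le
      (f := H ∘ ofComplex) (f' := fun w => H' (ofComplex w)) (C := C * Real.exp (-ε * z.im))
      (s := Icc (-M) M ×ℂ {z.im}) (x := Complex.I * z.im) (y := z) (fun w hw => ?_)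
      (fun w hw => ?_) (((convex_Icc _ _).linear_preimage Complex.reLm).inter
        ((convex_singleton _).linear_preimage Complex.imLm)) ?_ ?_
    · simp only [Function.comp_apply, ofComplex_apply] at key
      refine (le_trans (le_of_eq ?_) key).trans (mul_le_mul_of_nonneg_left ?_ hC)
      · simp [hdef]
      · have : (z : ℂ) - Complex.I * z.im = (z.re : ℂ) := by
          apply Complex.ext <;> simp
        rw [this, Complex.norm_real, Real.norm_eq_abs]
        exact hz
    · rw [Complex.mem_reProdIm] at hw
      have him : 0 < w.im := by rw [mem_singleton_iff.1 hw.2]; exact z.im_pos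
      have := hH (ofComplex w)
      rw [ofComplex_apply_of_im_pos him] at this ⊢
      exact this.hasDerivWithinAt
    · rw [Complex.mem_reProdIm] at hw
      have him : 0 < w.im := by rw [mem_singleton_iff.1 hw.2]; exact z.im_pos
      have := hbM ⟨w, him⟩ (abs_le.2 hw.1) (by
        change Y ≤ w.im
        rw [mem_singleton_iff.1 hw.2]; exact hzY)
      rw [ofComplex_apply_of_im_pos him]
      refine this.trans (le_of_eq ?_)
      change C * Real.exp (-ε * w.im) = _
      rw [mem_singleton_iff.1 hw.2]
    · rw [Complex.mem_reProdIm]; simpa using hM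
    · rw [Complex.mem_reProdIm]; simpa using abs_le.1 hz
  have := hdiff.add (hlim.comp (tendsto_im_stripFilter M))
  simpa using this

/-- `G` has limits at all points of `ℍ*`. -/
def HasExtLimits (Γ : Subgroup SL(2, ℝ)) (G : ℍ → ℂ) : Prop :=
  ∀ y : ExtUHP Γ, ∃ a, Tendsto G (extNhds y) (𝓝 a)

lemma continuous_of_hasDerivAt {F F' : ℍ → ℂ}
    (hF : ∀ z : ℍ, HasDerivAt (F ∘ ofComplex) (F' z) z) : Continuous F := by
  have : MDiff F := fun z => mdifferentiableAt_iff.2 (hF z).differentiableAt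
  exact this.continuous

/-- The primitives of `f(τ) (τ - t) ^ w G(τ) dτ` have limits at all points of `ℍ*`. -/
lemma hasExtLimits_of_hasDerivAt {Γ : Subgroup SL(2, ℝ)} {f G F : ℍ → ℂ} (hf : IsCuspidal Γ f)
    (t : LHP) (w : ℝ) (hG : HasExtLimits Γ G)
    (hF : ∀ z : ℍ, HasDerivAt (F ∘ ofComplex) (f z * ((z : ℂ) - t.1) ^ (w : ℂ) * G z) z) :
    HasExtLimits Γ F := by
  intro y
  cases y with
  | point z => exact ⟨F z, (continuous_of_hasDerivAt hF).tendsto z⟩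
  | cusp c hc =>
    obtain ⟨g, hg⟩ := exists_toGL_smul_infty c
    obtain ⟨b, hb⟩ := hG (.cusp c hc)
    obtain ⟨k, hk⟩ := hf.decay
    obtain ⟨a, ha⟩ := exists_tendsto_stripFilter (H := fun τ => F (g • τ))
      (fun z => hasDerivAt_comp_sl_smul g z (hF (g • z))) (fun M => by
        obtain ⟨ε, C, Y, hε, hC, hY, hbound⟩ :=
          hk.exists_bound (g := g) (by rwa [hg]) (abs_nonneg w) M
        -- Having a limit b at the cusp, G is bounded by ‖b‖ + 1 high up in the strip.
        have hev := ((tendsto_extNhds_cusp.1 hb g hg M).norm).eventually_le_const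
          (lt_add_one ‖b‖)
        obtain ⟨Y', hY'⟩ := eventually_stripFilter.1 hev
        refine ⟨ε, lhpSize t.1 ^ |w| * (‖b‖ + 1) * C, max Y Y', hε, fun z hz hzY => ?_⟩
        have h1 := hbound z hz ((le_max_left _ _).trans hzY)
        have h2 := hY' z hz ((le_max_right _ _).trans hzY)
        have h3 := norm_sub_cpow_le (g • z) t.2 w
        have h4 := one_le_lhpSize t.1
        rw [norm_mul, norm_mul, norm_mul]
        calc _ ≤ ‖f (g • z)‖ * ((1 + ‖((g • z : ℍ) : ℂ)‖) ^ |w| * lhpSize t.1 ^ |w|) *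
              (‖b‖ + 1) * ‖1 / denom (toGL g) z ^ 2‖ := by gcongr
          _ = lhpSize t.1 ^ |w| * (‖b‖ + 1) * (‖f (g • z)‖ *
              (1 + ‖((g • z : ℍ) : ℂ)‖) ^ |w| * ‖1 / denom (toGL g) z ^ 2‖) := by ring
          _ ≤ lhpSize t.1 ^ |w| * (‖b‖ + 1) * (C * Real.exp (-ε * z.im)) := by gcongr
          _ = _ := by ring)
    exact ⟨a, tendsto_extNhds_cusp_of_strip hg ha⟩

/-- The principal power is holomorphic in τ because τ - t stays in the upper half-plane. Convexity
of ℍ gives a primitive; subtracting its limit at x normalizes it. -/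
lemma exists_primitive {Γ : Subgroup SL(2, ℝ)} {f G : ℍ → ℂ} (hf : IsCuspidal Γ f)
    (t : LHP) (w : ℝ) (hG : HasExtLimits Γ G) (hGd : MDiff G) (x : ExtUHP Γ) :
    ∃ F : ℍ → ℂ,
      (∀ z : ℍ, HasDerivAt (F ∘ ofComplex) (f z * ((z : ℂ) - t.1) ^ (w : ℂ) * G z) z) ∧
        Tendsto F (extNhds x) (𝓝 0) := by
  have hd : DifferentiableOn ℂ
      (fun z : ℂ => (f ∘ ofComplex) z * (z - t.1) ^ (w : ℂ) * (G ∘ ofComplex) z) {z | 0 < z.im} := by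
    refine ((UpperHalfPlane.mdifferentiable_iff.1 hf.mdifferentiable).mul ?_).mul
      (UpperHalfPlane.mdifferentiable_iff.1 hGd)
    refine DifferentiableOn.cpow (by fun_prop) (by fun_prop) fun z hz => Or.inr (ne_of_gt ?_)
    change 0 < (z - t.1).im
    rw [Complex.sub_im]
    have h1 : 0 < z.im := hz
    have := t.2
    linarith
  obtain ⟨P, hP⟩ := (convex_halfSpace_im_gt 0).exists_forall_hasDerivWithinAt hd
  have hP' : ∀ z : ℍ, HasDerivAt ((fun τ : ℍ => P τ) ∘ ofComplex)
      (f z * ((z : ℂ) - t.1) ^ (w : ℂ) * G z) z := by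
    intro z
    have h1 := (hP z z.im_pos).hasDerivAt (isOpen_upperHalfPlaneSet.mem_nhds z.im_pos)
    simp only [Function.comp_apply, ofComplex_apply] at h1
    refine h1.congr_of_eventuallyEq ?_
    filter_upwards [eventuallyEq_coe_comp_ofComplex z.im_pos] with w hw
    exact congrArg P hw
  obtain ⟨a, ha⟩ := hasExtLimits_of_hasDerivAt hf t w hG hP' x
  exact ⟨fun τ => P τ - a, fun z => (hP' z).sub_const a, by simpa using ha.sub_const a⟩

/-- The difference is constant on the convex set ℍ and tends to 0 at x. Identities between iterated
integrals are thereby reduced to a comparison of derivatives and one limit. -/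
lemma eq_of_hasDerivAt_of_tendsto {Γ : Subgroup SL(2, ℝ)} {F₁ F₂ F' : ℍ → ℂ} {x : ExtUHP Γ}
    {a : ℂ} (h₁ : ∀ z : ℍ, HasDerivAt (F₁ ∘ ofComplex) (F' z) z)
    (h₂ : ∀ z : ℍ, HasDerivAt (F₂ ∘ ofComplex) (F' z) z)
    (l₁ : Tendsto F₁ (extNhds x) (𝓝 a)) (l₂ : Tendsto F₂ (extNhds x) (𝓝 a)) : F₁ = F₂ := by
  have hconst : ∀ z z' : ℍ, F₁ z - F₂ z = F₁ z' - F₂ z' := by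
    intro z z'
    have key := Convex.norm_image_sub_le_of_norm_hasDerivWithin_le
      (f := fun w => (F₁ ∘ ofComplex) w - (F₂ ∘ ofComplex) w) (f' := fun _ => 0) (C := 0)
      (s := {w : ℂ | 0 < w.im}) (x := (z' : ℂ)) (y := (z : ℂ)) (fun w hw => ?_) (by simp)
      (convex_halfSpace_im_gt 0) z'.im_pos z.im_pos
    · rw [zero_mul, norm_le_zero_iff, sub_eq_zero] at key
      simpa only [Function.comp_apply, ofComplex_apply] using key
    · have := (h₁ ⟨w, hw⟩).sub (h₂ ⟨w, hw⟩)
      rw [sub_self] at this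
      exact this.hasDerivWithinAt
  funext z
  have h3 := l₁.sub l₂
  have h4 : (fun τ => F₁ τ - F₂ τ) = fun _ => F₁ z - F₂ z := funext fun τ => hconst τ z
  rw [h4, sub_self] at h3
  exact sub_eq_zero.1 (tendsto_nhds_unique tendsto_const_nhds h3)

/-! ## Iterated primitives -/

/-- The iterated integral from `x` to a variable point of `ℍ`, as an iterated primitive. -/
noncomputable def iterPrim {Γ : Subgroup SL(2, ℝ)} (x : ExtUHP Γ) (t : LHP) :
    List ((ℍ → ℂ) × ℝ) → ℍ → ℂ
  | [] => fun _ => 1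
  | (f, w) :: L => Classical.epsilon fun F : ℍ → ℂ =>
      (∀ z : ℍ, HasDerivAt (F ∘ ofComplex)
        (f z * ((z : ℂ) - t.1) ^ (w : ℂ) * iterPrim x t L z) z) ∧
      Tendsto F (extNhds x) (𝓝 0)

section iterPrim

variable {Γ : Subgroup SL(2, ℝ)} (x : ExtUHP Γ) (t : LHP)

/-- One induction is needed for all three claims: holomorphy and limits at one stage make the next
primitive exist, and only then does `Classical.epsilon` satisfy its specification. -/
lemma iterPrim_aux (L : List ((ℍ → ℂ) × ℝ)) (hL : ∀ e ∈ L, IsCuspidal Γ e.1) :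
    MDiff (iterPrim x t L) ∧ HasExtLimits Γ (iterPrim x t L) ∧
    ∀ f w, IsCuspidal Γ f →
      (∀ z : ℍ, HasDerivAt (iterPrim x t ((f, w) :: L) ∘ ofComplex)
        (f z * ((z : ℂ) - t.1) ^ (w : ℂ) * iterPrim x t L z) z) ∧
      Tendsto (iterPrim x t ((f, w) :: L)) (extNhds x) (𝓝 0) := by
  have step : MDiff (iterPrim x t L) → HasExtLimits Γ (iterPrim x t L) →
      ∀ f w, IsCuspidal Γ f →
      (∀ z : ℍ, HasDerivAt (iterPrim x t ((f, w) :: L) ∘ ofComplex)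
        (f z * ((z : ℂ) - t.1) ^ (w : ℂ) * iterPrim x t L z) z) ∧
      Tendsto (iterPrim x t ((f, w) :: L)) (extNhds x) (𝓝 0) := fun h1 h2 f w hf =>
    Classical.epsilon_spec (exists_primitive hf t w h2 h1 x)
  induction L with
  | nil =>
    have h1 : MDiff (iterPrim x t []) := mdifferentiable_const
    have h2 : HasExtLimits Γ (iterPrim x t []) := fun y => ⟨1, tendsto_const_nhds⟩
    exact ⟨h1, h2, step h1 h2⟩
  | cons e L ih =>
    obtain ⟨f, w⟩ := e
    have hf : IsCuspidal Γ f := hL (f, w) List.mem_cons_self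
    have hL' : ∀ e ∈ L, IsCuspidal Γ e.1 := fun e he => hL e (List.mem_cons_of_mem _ he)
    obtain ⟨-, h2, h3⟩ := ih hL' fun h1 h2 f w hf =>
      Classical.epsilon_spec (exists_primitive hf t w h2 h1 x)
    have h4 := (h3 f w hf).1
    have h5 : MDiff (iterPrim x t ((f, w) :: L)) :=
      fun z => mdifferentiableAt_iff.2 (h4 z).differentiableAt
    have h6 := hasExtLimits_of_hasDerivAt hf t w h2 h4
    exact ⟨h5, h6, step h5 h6⟩

lemma hasExtLimits_iterPrim {L : List ((ℍ → ℂ) × ℝ)} (hL : ∀ e ∈ L, IsCuspidal Γ e.1) :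
    HasExtLimits Γ (iterPrim x t L) := (iterPrim_aux x t L hL).2.1

lemma hasDerivAt_iterPrim {L : List ((ℍ → ℂ) × ℝ)} (hL : ∀ e ∈ L, IsCuspidal Γ e.1)
    {f : ℍ → ℂ} (hf : IsCuspidal Γ f) (w : ℝ) (z : ℍ) :
    HasDerivAt (iterPrim x t ((f, w) :: L) ∘ ofComplex)
      (f z * ((z : ℂ) - t.1) ^ (w : ℂ) * iterPrim x t L z) z :=
  ((iterPrim_aux x t L hL).2.2 f w hf).1 z

lemma tendsto_iterPrim_cons {L : List ((ℍ → ℂ) × ℝ)} (hL : ∀ e ∈ L, IsCuspidal Γ e.1)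
    {f : ℍ → ℂ} (hf : IsCuspidal Γ f) (w : ℝ) :
    Tendsto (iterPrim x t ((f, w) :: L)) (extNhds x) (𝓝 0) :=
  ((iterPrim_aux x t L hL).2.2 f w hf).2

end iterPrim

/-- Fundamental theorem of calculus with an improper lower end: along p the primitive has derivative
`pathIntegrand`, and it tends to 0 at the start. -/
lemma iterInt_eq_iterPrim {Γ : Subgroup SL(2, ℝ)} {p : ℝ → ℍ} {x y : ExtUHP Γ}
    (hp : IsPathFromTo p x y) (t : LHP) (L : List ((ℍ → ℂ) × ℝ))
    (hL : ∀ e ∈ L, IsCuspidal Γ e.1) {s : ℝ} (hs : s ∈ Ioo (0 : ℝ) 1) :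
    iterInt p t L s = iterPrim x t L (p s) := by
  induction L generalizing s with
  | nil => rfl
  | cons e L ih =>
    have hcons := hL
    obtain ⟨f, w⟩ := e
    have hf : IsCuspidal Γ f := hL (f, w) List.mem_cons_self
    have hL : ∀ e ∈ L, IsCuspidal Γ e.1 := fun e he => hL e (List.mem_cons_of_mem _ he)
    obtain ⟨_, _, _, _, h⟩ := exists_bound_iterInt hp ((f, w) :: L) hcons
    have hint := (h t).1.1
    have hsub : uIcc 0 s ⊆ uIcc (0 : ℝ) 1 := by
      rw [uIcc_of_le zero_le_one, uIcc_of_le hs.1.le]; exact Icc_subset_Icc_right hs.2.le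
    have hder : ∀ r ∈ Ioo (0 : ℝ) 1, HasDerivAt (fun r => iterPrim x t ((f, w) :: L) (p r))
        (pathIntegrand p t f w (iterInt p t L) r) r := by
      intro r hr
      have h1 := (hasDerivAt_iterPrim x t hL hf w (p r))
      have h2 := HasDerivAt.comp r h1 (hp.hasDerivAt hr)
      simp only [Function.comp_def, ofComplex_apply] at h2
      rw [pathIntegrand, ih hL hr]
      exact h2
    have key := intervalIntegral.integral_eq_sub_of_hasDerivAt_of_tendsto hs.1
      (fun r hr => hder r ⟨hr.1, hr.2.trans hs.2⟩) (hint.mono_set hsub)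
      ((tendsto_iterPrim_cons x t hL hf w).comp hp.startsAt.tendsto)
      ((hder s hs).continuousAt.tendsto.mono_left nhdsWithin_le_nhds)
    rw [iterInt, key, sub_zero]

/-- The iterated integral along an admissible path is the limit at its end point of the iterated
primitive; in particular it depends only on the end points. -/
theorem iterInt_one_eq {Γ : Subgroup SL(2, ℝ)} {p : ℝ → ℍ} {x y : ExtUHP Γ}
    (hp : IsPathFromTo p x y) (t : LHP) {L : List ((ℍ → ℂ) × ℝ)}
    (hL : ∀ e ∈ L, IsCuspidal Γ e.1) {a : ℂ} (ha : Tendsto (iterPrim x t L) (extNhds y) (𝓝 a)) :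
    iterInt p t L 1 = a := by
  obtain ⟨_, _, _, _, h⟩ := exists_bound_iterInt hp L hL
  have h1 := ((h t).2.1 1 (right_mem_Icc.2 zero_le_one)).tendsto.mono_left
    (nhdsWithin_mono 1 Ioo_subset_Icc_self)
  rw [nhdsWithin_Ioo_eq_nhdsLT zero_lt_one] at h1
  refine tendsto_nhds_unique h1 ((ha.comp hp.tendsto_end).congr' ?_)
  filter_upwards [Ioo_mem_nhdsLT zero_lt_one] with s hs
  exact (iterInt_eq_iterPrim hp t L hL hs).symm

/-! ## Powers and Möbius transformations -/

lemma cpowLower_eq_exp {z : ℂ} (hz : z ≠ 0) (r : ℝ) :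
    cpowLower z r = Complex.exp (conj (Complex.log (conj z)) * r) := by
  rw [cpowLower, Complex.cpow_def_of_ne_zero (by simpa using hz), ← Complex.exp_conj, map_mul,
    Complex.conj_ofReal]

lemma cpowLower_zero (z : ℂ) : cpowLower z 0 = 1 := by simp [cpowLower]

lemma cpowLower_add {z : ℂ} (hz : z ≠ 0) (r s : ℝ) :
    cpowLower z (r + s) = cpowLower z r * cpowLower z s := by
  simp only [cpowLower_eq_exp hz, ← Complex.exp_add]
  push_cast
  ring_nf

lemma LHP.denom_ne_zero (g : SL(2, ℝ)) (t : LHP) : (g 1 0 : ℂ) * t.1 + g 1 1 ≠ 0 := by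
  have := denom_ne_zero_of_im (toGL g) t.2.ne
  rwa [denom_toGL] at this

/-- With the chosen branches, `(γ τ - γ t) ^ w (c τ + d) ^ w (c t + d) ^ w = (τ - t) ^ w`. -/
lemma moebius_sub_cpow (g : SL(2, ℝ)) (τ : ℍ) (t : LHP) (w : ℝ) :
    (((g • τ : ℍ) : ℂ) - (t.moebius g).1) ^ (w : ℂ) * denom (toGL g) τ ^ (w : ℂ) *
      cpowLower ((g 1 0 : ℂ) * t.1 + g 1 1) w = ((τ : ℂ) - t.1) ^ (w : ℂ) := by
  have hD : denom (toGL g) τ ≠ 0 := denom_ne_zero (toGL g) τ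
  have hE := t.denom_ne_zero g
  have hdet : (g 0 0 : ℂ) * g 1 1 - g 0 1 * g 1 0 = 1 := by exact_mod_cast sl_det g
  have hprod : (((g • τ : ℍ) : ℂ) - (t.moebius g).1) * denom (toGL g) τ *
      ((g 1 0 : ℂ) * t.1 + g 1 1) = (τ : ℂ) - t.1 := by
    have key : ∀ {a b c d τ t : ℂ}, c * τ + d ≠ 0 → c * t + d ≠ 0 → a * d - b * c = 1 →
        ((a * τ + b) / (c * τ + d) - (a * t + b) / (c * t + d)) * (c * τ + d) * (c * t + d) =
          τ - t := by
      intro a b c d τ t h1 h2 h3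
      rw [div_sub_div _ _ h1 h2, mul_assoc, div_mul_cancel₀ _ (mul_ne_zero h1 h2)]
      linear_combination (τ - t) * h3
    rw [coe_sl_smul, LHP.moebius]
    rw [denom_toGL] at hD ⊢
    exact key hD hE hdet
  set a : ℂ := ((g • τ : ℍ) : ℂ) - (t.moebius g).1
  set D := denom (toGL g) τ
  set E : ℂ := (g 1 0 : ℂ) * t.1 + g 1 1
  have him : ∀ (σ : ℍ) (u : LHP), 0 < ((σ : ℂ) - u.1).im := fun σ u => by
    have h1 := σ.im_pos
    have h2 := u.2
    rw [Complex.sub_im, coe_im]; linarith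
  have ha : 0 < a.im := him _ _
  have hpos := him τ t
  have ha0 : a ≠ 0 := fun h => by simp [h] at ha
  have hsub0 : (τ : ℂ) - t.1 ≠ 0 := fun h => by simp [h] at hpos
  have hE' : conj E ≠ 0 := by simpa using hE
  -- Λ is the sum of the chosen logarithms, so exp Λ = τ - t; it is the principal logarithm once Im
  -- Λ lies in (-π, π].
  set Λ := Complex.log a + Complex.log D + conj (Complex.log (conj E)) with hΛ
  have hexp : Complex.exp Λ = (τ : ℂ) - t.1 := by
    rw [hΛ, Complex.exp_add, Complex.exp_add, Complex.exp_log ha0, Complex.exp_log hD,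
      Complex.exp_conj, Complex.exp_log hE', Complex.conj_conj, hprod]
  have hΛim : Λ.im = a.arg + D.arg - (conj E).arg := by
    simp [hΛ, Complex.log_im, sub_eq_add_neg]
  have hrange : -Real.pi < Λ.im ∧ Λ.im ≤ Real.pi := by
    have h1 : 0 ≤ a.arg := Complex.arg_nonneg_iff.2 ha.le
    have h2 : a.arg < Real.pi := Complex.arg_lt_pi_iff.2 (Or.inr ha.ne')
    have hDim : D.im = g 1 0 * τ.im := by simp [D, denom_toGL]
    have hEim : (conj E).im = g 1 0 * -t.1.im := by simp [E]
    have ht := t.2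
    -- The arguments of cτ+d and of the conjugate of ct+d are governed by the sign of c, and they
    -- enter Im Λ with opposite signs.
    have h3 : -Real.pi < Λ.im ∧ Λ.im < 2 * Real.pi := by
      rw [hΛim]
      rcases lt_trichotomy (g 1 0) 0 with hc | hc | hc
      · have h4 : D.arg < 0 := Complex.arg_neg_iff.2 (by rw [hDim]; nlinarith [τ.im_pos])
        have h5 : (conj E).arg < 0 := Complex.arg_neg_iff.2 (by rw [hEim]; nlinarith)
        have := Complex.neg_pi_lt_arg D
        have := Complex.neg_pi_lt_arg (conj E)
        constructor <;> linarith
      -- For d < 0 the arguments of cτ+d and ct+d are π and -π: the convention [-π, π) on the lower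
      -- half-plane makes them cancel.
      · have : D = conj E := by simp [D, E, denom_toGL, hc]
        rw [this]
        constructor <;> linarith [Real.pi_pos]
      · have h4 : 0 < D.im := by rw [hDim]; nlinarith [τ.im_pos]
        have h5 : 0 < (conj E).im := by rw [hEim]; nlinarith
        have := Complex.arg_nonneg_iff.2 h4.le
        have := Complex.arg_nonneg_iff.2 h5.le
        have := Complex.arg_lt_pi_iff.2 (Or.inr h4.ne')
        have := Complex.arg_lt_pi_iff.2 (Or.inr h5.ne')
        constructor <;> linarith
    refine ⟨h3.1, ?_⟩
    -- Im Λ in (π, 2π) would give sin(Im Λ) ≤ 0, contradicting Im(τ-t) > 0.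
    by_contra! hlt
    have hsin : Real.sin Λ.im ≤ 0 := by
      have := Real.sin_nonneg_of_nonneg_of_le_pi (x := Λ.im - Real.pi) (by linarith)
        (by linarith [h3.2])
      rw [Real.sin_sub_pi] at this
      linarith
    rw [← hexp, Complex.exp_im] at hpos
    have := Real.exp_pos Λ.re
    nlinarith
  have hlog : Complex.log ((τ : ℂ) - t.1) = Λ := by
    rw [← hexp, Complex.log_exp hrange.1 hrange.2]
  rw [Complex.cpow_def_of_ne_zero ha0, Complex.cpow_def_of_ne_zero hD, cpowLower_eq_exp hE,
    Complex.cpow_def_of_ne_zero hsub0, hlog, ← Complex.exp_add, ← Complex.exp_add, hΛ]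
  ring_nf

/-! ### Iterated integrals of cusp families and the coefficients of J -/

namespace WeightSystem

variable {Γ : Subgroup SL(2, ℝ)} {ℓ : ℕ} (A : WeightSystem Γ ℓ)

lemma wt_append (m m' : List (Fin ℓ)) : A.wt (m ++ m') = A.wt m + A.wt m' := by
  simp [wt]

lemma mult_append (m m' : List (Fin ℓ)) (γ : Γ) :
    A.mult (m ++ m') γ = A.mult m γ * A.mult m' γ := by
  simp [mult]

lemma mult_ne_zero (m : List (Fin ℓ)) (γ : Γ) : A.mult m γ ≠ 0 := by
  refine List.prod_ne_zero fun h => ?_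
  obtain ⟨j, -, hj⟩ := List.mem_map.1 h
  have := (A.isMultiplier j).norm_eq_one γ
  rw [hj, norm_zero] at this
  exact zero_ne_one this

namespace CuspFamily

variable {A} (h : A.CuspFamily)

lemma isCuspidal_factors (L : List A.monomials) : ∀ e ∈ h.factors L, IsCuspidal Γ e.1 := by
  intro e he
  obtain ⟨B, -, rfl⟩ := List.mem_map.1 he
  exact ⟨(h B).2.1, _, (h B).2.2.2⟩

lemma isCuspidal_apply (B : A.monomials) : IsCuspidal Γ (h B : ℍ → ℂ) :=
  ⟨(h B).2.1, _, (h B).2.2.2⟩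

/-- The bridge from integrals to primitives: R is the boundary value at y of the iterated primitive
from x. The algebraic identities below are limits of identities between primitives. -/
lemma tendsto_R (L : List A.monomials) (y x : ExtUHP Γ) (t : LHP) :
    Tendsto (iterPrim x t (h.factors L)) (extNhds y) (𝓝 (h.R L y x t)) := by
  obtain ⟨a, ha⟩ := hasExtLimits_iterPrim x t (h.isCuspidal_factors L) y
  rw [R, iterInt_one_eq (isPathFromTo_stdPath x y) t (h.isCuspidal_factors L) ha]
  exact ha

lemma R_eq_of_tendsto {L : List A.monomials} {y x : ExtUHP Γ} {t : LHP} {a : ℂ}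
    (ha : Tendsto (iterPrim x t (h.factors L)) (extNhds y) (𝓝 a)) : h.R L y x t = a :=
  tendsto_nhds_unique (h.tendsto_R L y x t) ha

lemma R_nil (y x : ExtUHP Γ) (t : LHP) : h.R [] y x t = 1 := rfl

lemma R_self_of_ne_nil {L : List A.monomials} (hL : L ≠ []) (x : ExtUHP Γ) (t : LHP) :
    h.R L x x t = 0 := by
  cases L with
  | nil => exact absurd rfl hL
  | cons B L =>
    exact h.R_eq_of_tendsto
      (tendsto_iterPrim_cons x t (h.isCuspidal_factors L) (h.isCuspidal_apply B) _)

/-! ### Equivariance -/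

/-- Both sides vanish at x and, by induction on the list, have the same derivative: transformation
of the cusp form, of dτ and of (τ-t)^w leave only v(γ) and the power of ct+d. -/
lemma iterPrim_smul (γ : Γ) (x : ExtUHP Γ) (t : LHP) (L : List A.monomials) (z : ℍ) :
    iterPrim (γ • x) (t.moebius γ) (h.factors L) ((γ : SL(2, ℝ)) • z) *
        cpowLower (((γ : SL(2, ℝ)) 1 0 : ℂ) * t.1 + ((γ : SL(2, ℝ)) 1 1 : ℂ))
          (A.wt (L.map Subtype.val).flatten) =
      A.mult (L.map Subtype.val).flatten γ * iterPrim x t (h.factors L) z := by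
  have hE := t.denom_ne_zero (γ : SL(2, ℝ))
  set E : ℂ := ((γ : SL(2, ℝ)) 1 0 : ℂ) * t.1 + ((γ : SL(2, ℝ)) 1 1 : ℂ) with hEdef
  induction L generalizing z with
  | nil => simp [factors, iterPrim, wt, mult, cpowLower_zero]
  | cons B L ih =>
    have hcL := h.isCuspidal_factors L
    have hcB := h.isCuspidal_apply B
    rw [List.map_cons, List.flatten_cons, wt_append, mult_append, cpowLower_add hE]
    set W := A.wt (L.map Subtype.val).flatten
    set V := A.mult (L.map Subtype.val).flatten γ
    refine congrFun (eq_of_hasDerivAt_of_tendsto (x := x) (a := 0)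
      (F₁ := fun z => iterPrim (γ • x) (t.moebius γ) (h.factors (B :: L)) ((γ : SL(2, ℝ)) • z) *
        (cpowLower E (A.wt B) * cpowLower E W))
      (F₂ := fun z => A.mult B γ * V * iterPrim x t (h.factors (B :: L)) z)
      (F' := fun z => A.mult B γ * V *
        ((h B : ℍ → ℂ) z * ((z : ℂ) - t.1) ^ (A.wt B : ℂ) * iterPrim x t (h.factors L) z))
      (fun z => ?_) (fun z => ?_) ?_ ?_) z
    · have h1 := (hasDerivAt_comp_sl_smul (γ : SL(2, ℝ)) z
        (hasDerivAt_iterPrim (γ • x) (t.moebius γ) hcL hcB (A.wt B)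
          ((γ : SL(2, ℝ)) • z))).mul_const (cpowLower E (A.wt B) * cpowLower E W)
      refine HasDerivAt.congr_deriv h1 ?_
      have h2 := (h B).2.2.1 γ z
      have h3 := moebius_sub_cpow (γ : SL(2, ℝ)) z t (A.wt B)
      have h4 := ih z
      have hD : denom (toGL (γ : SL(2, ℝ))) z ≠ 0 := denom_ne_zero _ z
      rw [autFactor, Complex.ofReal_add, Complex.cpow_add _ _ hD, Complex.ofReal_ofNat,
        Complex.cpow_ofNat] at h2
      rw [h2, ← h3]
      calc _ = A.mult B γ * (h B : ℍ → ℂ) z * ((((γ : SL(2, ℝ)) • z : ℍ) : ℂ) -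
            (t.moebius γ).1) ^ (A.wt B : ℂ) * denom (toGL (γ : SL(2, ℝ))) z ^ (A.wt B : ℂ) *
            cpowLower E (A.wt B) * (iterPrim (γ • x) (t.moebius γ) (h.factors L)
              ((γ : SL(2, ℝ)) • z) * cpowLower E W) := by
            field_simp
        _ = _ := by rw [h4]; ring
    · exact (hasDerivAt_iterPrim x t hcL hcB (A.wt B) z).const_mul (A.mult B γ * V)
    · have h1 := ((tendsto_iterPrim_cons (γ • x) (t.moebius γ) hcL hcB (A.wt B)).comp
        (tendsto_smul_extNhds γ x)).mul_const (cpowLower E (A.wt B) * cpowLower E W)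
      rw [zero_mul] at h1
      exact h1
    · have h1 := (tendsto_iterPrim_cons x t hcL hcB (A.wt B)).const_mul (A.mult B γ * V)
      rw [mul_zero] at h1
      exact h1

lemma R_smul (γ : Γ) (L : List A.monomials) (y x : ExtUHP Γ) (t : LHP) :
    h.R L (γ • y) (γ • x) (t.moebius γ) *
        cpowLower (((γ : SL(2, ℝ)) 1 0 : ℂ) * t.1 + ((γ : SL(2, ℝ)) 1 1 : ℂ))
          (A.wt (L.map Subtype.val).flatten) =
      A.mult (L.map Subtype.val).flatten γ * h.R L y x t := by
  have h1 := ((h.tendsto_R L (γ • y) (γ • x) (t.moebius γ)).comp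
    (tendsto_smul_extNhds γ y)).mul_const
      (cpowLower (((γ : SL(2, ℝ)) 1 0 : ℂ) * t.1 + ((γ : SL(2, ℝ)) 1 1 : ℂ))
          (A.wt (L.map Subtype.val).flatten))
  simp only [Function.comp_apply, h.iterPrim_smul γ x t L] at h1
  exact tendsto_nhds_unique h1 ((h.tendsto_R L y x t).const_mul _)

lemma J_apply (y x : ExtUHP Γ) (m : List (Fin ℓ)) (t : LHP) :
    h.J y x m t = ∑ L ∈ (A.finite_factorizations m).toFinset, h.R L y x t :=
  finsum_mem_eq_finite_toFinset_sum _ _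

lemma mem_factorizations {m : List (Fin ℓ)} {L : List A.monomials} :
    L ∈ (A.finite_factorizations m).toFinset ↔ (L.map Subtype.val).flatten = m := by
  simp

/-- Every factorization of m has the weight and multiplier of m itself, so the factor in `R_smul`
comes out of the sum. -/
theorem J_inv_smul (γ : Γ) (y x : ExtUHP Γ) :
    h.J (γ⁻¹ • y) (γ⁻¹ • x) = A.slash (h.J y x) γ := by
  funext m t
  rw [slash, J_apply, J_apply, Finset.mul_sum]
  refine Finset.sum_congr rfl fun L hL => ?_
  have key := h.R_smul γ L (γ⁻¹ • y) (γ⁻¹ • x) t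
  rw [mem_factorizations.1 hL, smul_inv_smul, smul_inv_smul] at key
  rw [mul_assoc, mul_comm (cpowLower _ _), key, inv_mul_cancel_left₀ (A.mult_ne_zero m γ)]

/-! ### Composition of paths -/

/-- Chen's formula: the integration variables lying beyond y form an initial segment of the list. By
induction both sides have the same derivative in z; as z → y only the term i = 0 survives, and its
value is the integral from x to y. -/
lemma iterPrim_split (y x : ExtUHP Γ) (t : LHP) (L : List A.monomials) (z : ℍ) :
    iterPrim x t (h.factors L) z = ∑ i ∈ Finset.range (L.length + 1),
      iterPrim y t (h.factors (L.take i)) z * h.R (L.drop i) y x t := by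
  induction L generalizing z with
  | nil => simp [factors, iterPrim, R_nil]
  | cons B L ih =>
    have hcB := h.isCuspidal_apply B
    -- Split off i = 0, constant in z; every other term keeps B as its outermost form.
    rw [List.length_cons, Finset.sum_range_succ']
    simp only [List.take_succ_cons, List.drop_succ_cons, List.take_zero, List.drop_zero]
    refine congrFun (eq_of_hasDerivAt_of_tendsto (x := y) (a := h.R (B :: L) y x t)
      (F' := fun z => (h B : ℍ → ℂ) z * ((z : ℂ) - t.1) ^ (A.wt B : ℂ) *
        iterPrim x t (h.factors L) z)
      (F₂ := fun z => (∑ i ∈ Finset.range (L.length + 1),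
        iterPrim y t (h.factors (B :: L.take i)) z * h.R (L.drop i) y x t) +
          iterPrim y t (h.factors []) z * h.R (B :: L) y x t)
      (fun z => ?_) (fun z => ?_) ?_ ?_) z
    · exact hasDerivAt_iterPrim x t (h.isCuspidal_factors L) hcB (A.wt B) z
    · have h1 : HasDerivAt (fun w : ℂ => (∑ i ∈ Finset.range (L.length + 1),
          (iterPrim y t (h.factors (B :: L.take i)) ∘ ofComplex) w * h.R (L.drop i) y x t) +
            1 * h.R (B :: L) y x t)
          (∑ i ∈ Finset.range (L.length + 1), (h B : ℍ → ℂ) z * ((z : ℂ) - t.1) ^ (A.wt B : ℂ) *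
            iterPrim y t (h.factors (L.take i)) z * h.R (L.drop i) y x t) z :=
        (HasDerivAt.fun_sum fun i _ => (hasDerivAt_iterPrim y t (h.isCuspidal_factors (L.take i))
          hcB (A.wt B) z).mul_const _).add_const _
      refine HasDerivAt.congr_deriv h1 ?_
      rw [ih z, Finset.mul_sum]
      exact Finset.sum_congr rfl fun i _ => by ring
    · exact h.tendsto_R (B :: L) y x t
    · have h1 := (tendsto_finsetSum (Finset.range (L.length + 1)) fun i _ =>
        (tendsto_iterPrim_cons y t (h.isCuspidal_factors (L.take i)) hcB (A.wt B)).mul_const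
          (h.R (L.drop i) y x t)).add
        ((tendsto_const_nhds (x := (1 : ℂ))).mul_const (h.R (B :: L) y x t))
      simp only [zero_mul, Finset.sum_const_zero, zero_add, one_mul] at h1
      refine h1.congr fun z => ?_
      rw [show h.factors [] = [] from rfl, iterPrim, one_mul]
      rfl

lemma R_split (z y x : ExtUHP Γ) (t : LHP) (L : List A.monomials) :
    h.R L z x t = ∑ i ∈ Finset.range (L.length + 1),
      h.R (L.take i) z y t * h.R (L.drop i) y x t := by
  refine h.R_eq_of_tendsto ?_
  rw [funext (h.iterPrim_split y x t L)]
  exact tendsto_finsetSum _ fun i _ => (h.tendsto_R (L.take i) z y t).mul_const _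

theorem J_mul_J (z y x : ExtUHP Γ) : h.J z x = h.J z y * h.J y x := by
  funext m t
  rw [NCSeries.mul_apply, Finset.sum_apply, J_apply]
  simp only [Pi.mul_apply, J_apply, Finset.sum_mul_sum, h.R_split z y x t,
    ← Finset.sum_product']
  rw [Finset.sum_sigma', Finset.sum_sigma']
  -- A factorization of m cut after j blocks corresponds to a cut of the word m together with
  -- factorizations of both halves. The cut of m is at the total length of the first j blocks.
  refine Finset.sum_bij' (fun a _ => ⟨((a.1.take a.2).map Subtype.val).flatten.length,
      (a.1.take a.2, a.1.drop a.2)⟩)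
    (fun b _ => ⟨b.2.1 ++ b.2.2, b.2.1.length⟩) ?_ ?_ ?_ ?_ ?_
  · rintro ⟨L, j⟩ ha
    simp only [Finset.mem_sigma, mem_factorizations, Finset.mem_range, Finset.mem_product] at ha ⊢
    have hm : ((L.take j).map Subtype.val).flatten ++ ((L.drop j).map Subtype.val).flatten = m := by
      rw [← List.flatten_append, ← List.map_append, List.take_append_drop, ha.1]
    refine ⟨?_, ?_, ?_⟩
    · rw [← hm, List.length_append]; omega
    · rw [← hm, List.take_left']; rfl
    · rw [← hm, List.drop_left']; rfl
  · rintro ⟨i, L₁, L₂⟩ hb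
    simp only [Finset.mem_sigma, mem_factorizations, Finset.mem_range, Finset.mem_product] at hb ⊢
    refine ⟨?_, ?_⟩
    · rw [List.map_append, List.flatten_append, hb.2.1, hb.2.2, List.take_append_drop]
    · rw [List.length_append]; omega
  · rintro ⟨L, j⟩ ha
    simp only [Finset.mem_sigma, Finset.mem_range] at ha
    simp only [List.take_append_drop, List.length_take, Sigma.mk.injEq, heq_eq_eq, true_and]
    omega
  · rintro ⟨i, L₁, L₂⟩ hb
    simp only [Finset.mem_sigma, mem_factorizations, Finset.mem_range, Finset.mem_product] at hb
    simp only [List.take_left', List.drop_left', hb.2.1, List.length_take, Sigma.mk.injEq,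
      heq_eq_eq, and_true]
    omega
  · rintro ⟨L, j⟩ ha
    rfl

/-! ### Constant term and diagonal values of J -/

lemma factorizations_nil {L : List A.monomials} :
    (L.map Subtype.val).flatten = [] ↔ L = [] := by
  constructor
  · intro hL
    cases L with
    | nil => rfl
    | cons B L => simp [B.2.1] at hL
  · rintro rfl; rfl

lemma J_nil (y x : ExtUHP Γ) : h.J y x [] = 1 := by
  funext t
  have : (A.finite_factorizations []).toFinset = {[]} := by
    ext L; rw [mem_factorizations, factorizations_nil, Finset.mem_singleton]
  rw [J_apply, this, Finset.sum_singleton, R_nil]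
  rfl

theorem J_self (x : ExtUHP Γ) : h.J x x = 1 := by
  funext m
  by_cases hm : m = []
  · rw [hm, J_nil]; rfl
  · funext t
    rw [J_apply, NCSeries.one_apply, if_neg hm]
    refine Finset.sum_eq_zero fun L hL => h.R_self_of_ne_nil ?_ x t
    rintro rfl
    exact hm (mem_factorizations.1 hL).symm

end CuspFamily

end WeightSystem

/-! ## Holomorphic dependence on `t` -/

/-- Integrals of holomorphic functions depending measurably on a parameter are holomorphic, if
they are locally uniformly dominated. -/
lemma differentiableOn_integral_of_dominated {α : Type*} [MeasurableSpace α] {μ : Measure α}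
    {U : Set ℂ} (hU : IsOpen U) {K : ℂ → α → ℂ}
    (hmeas : ∀ t ∈ U, AEStronglyMeasurable (K t) μ)
    (hhol : ∀ᵐ r ∂μ, DifferentiableOn ℂ (K · r) U)
    (hbound : ∀ T ⊆ U, IsCompact T → ∃ g : α → ℝ, Integrable g μ ∧
      ∀ᵐ r ∂μ, ∀ t ∈ T, ‖K t r‖ ≤ g r) :
    DifferentiableOn ℂ (fun t => ∫ r, K t r ∂μ) U := by
  intro t₀ ht₀
  obtain ⟨ρ, hρ, hball⟩ := Metric.nhds_basis_closedBall.mem_iff.1 (hU.mem_nhds ht₀)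
  obtain ⟨g, hg, hKg⟩ := hbound _ hball (isCompact_closedBall t₀ ρ)
  have hsub : ∀ t ∈ Metric.ball t₀ (ρ / 2), Metric.closedBall t (ρ / 2) ⊆ Metric.closedBall t₀ ρ :=
    fun t ht => Metric.closedBall_subset_closedBall' (by
      have := Metric.mem_ball.1 ht; linarith)
  have hballU : ∀ t ∈ Metric.ball t₀ (ρ / 2), t ∈ U := fun t ht =>
    hball (hsub t ht (Metric.mem_closedBall_self (half_pos hρ).le))
  have hder : ∀ᵐ r ∂μ, ∀ t ∈ Metric.ball t₀ (ρ / 2),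
      HasDerivAt (K · r) (deriv (K · r) t) t := by
    filter_upwards [hhol] with r hr t ht
    exact (hr.differentiableAt (hU.mem_nhds (hballU t ht))).hasDerivAt
  have ht₀' : t₀ ∈ Metric.ball t₀ (ρ / 2) := Metric.mem_ball_self (half_pos hρ)
  have hmem : t₀ ∈ Metric.closedBall t₀ ρ := Metric.mem_closedBall_self hρ.le
  -- The bound for the derivative is Cauchy's estimate on circles of radius ρ/2, which stay inside
  -- the ball of radius ρ where g dominates.
  have key := hasDerivAt_integral_of_dominated_loc_of_deriv_le (μ := μ) (F := K)
    (F' := fun t r => deriv (K · r) t) (x₀ := t₀) (s := Metric.ball t₀ (ρ / 2))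
    (bound := fun r => g r / (ρ / 2)) (Metric.ball_mem_nhds _ (half_pos hρ)) ?_ ?_ ?_ ?_
    (hg.div_const _) hder
  · exact key.2.differentiableAt.differentiableWithinAt
  · filter_upwards [hU.mem_nhds ht₀] with t ht using hmeas t ht
  · exact hg.mono' (hmeas t₀ ht₀) (hKg.mono fun r hr => hr t₀ hmem)
  -- The derivative in t is measurable in r as a limit of difference quotients along the sequence t₀
  -- + ε n.
  · set ε : ℕ → ℂ := fun n => ((ρ / ((n : ℝ) + 1) : ℝ) : ℂ)
    have hε0 : Tendsto ε atTop (𝓝 0) := by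
      have : Tendsto (fun n : ℕ => ρ / ((n : ℝ) + 1)) atTop (𝓝 0) := by
        simpa [div_eq_mul_inv] using tendsto_one_div_add_atTop_nhds_zero_nat.const_mul ρ
      exact (Complex.continuous_ofReal.tendsto' 0 0 Complex.ofReal_zero).comp this
    have hεne : ∀ n, ε n ≠ 0 := fun n => by
      simp only [ε, ne_eq, Complex.ofReal_eq_zero]; positivity
    have hεU : ∀ n, t₀ + ε n ∈ U := fun n => hball (by
      rw [Metric.mem_closedBall, dist_self_add_left, Complex.norm_real, Real.norm_eq_abs,
        abs_of_pos (by positivity)]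
      exact div_le_self hρ.le (by linarith [(Nat.cast_nonneg n : (0 : ℝ) ≤ n)]))
    refine aestronglyMeasurable_of_tendsto_ae atTop
      (f := fun n r => (ε n)⁻¹ • (K (t₀ + ε n) r - K t₀ r))
      (fun n => ((hmeas _ (hεU n)).sub (hmeas _ ht₀)).const_smul (ε n)⁻¹) ?_
    filter_upwards [hder] with r hr
    have h1 := hasDerivAt_iff_tendsto_slope_zero.1 (hr t₀ ht₀')
    exact h1.comp (tendsto_nhdsWithin_iff.2 ⟨hε0, Eventually.of_forall hεne⟩)
  · filter_upwards [hKg, hhol] with r hr hr' t ht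
    refine Complex.norm_deriv_le_of_forall_mem_sphere_norm_le (half_pos hρ) ?_ fun z hz =>
      hr z (hsub t ht (Metric.sphere_subset_closedBall hz))
    refine (hr'.mono ?_).diffContOnCl
    rw [closure_ball _ (half_pos hρ).ne']
    exact (hsub t ht).trans hball

lemma isOpen_im_neg : IsOpen {t : ℂ | t.im < 0} := isOpen_lt Complex.continuous_im continuous_const

lemma exists_lhp_eq {t : ℂ} (ht : t ∈ {t : ℂ | t.im < 0}) : ∃ u : LHP, u.1 = t := ⟨⟨t, ht⟩, rfl⟩

lemma extend_apply_lhp (φ : LHP → ℂ) (t : LHP) :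
    Function.extend (fun t : LHP => t.1) φ 0 t.1 = φ t :=
  Subtype.val_injective.extend_apply φ 0 t

lemma continuousOn_lhpSize : ContinuousOn lhpSize {t : ℂ | t.im < 0} :=
  (continuousOn_const.add continuous_norm.continuousOn).add
    (Complex.continuous_im.abs.continuousOn.inv₀ fun _ ht => (abs_pos.2 (ne_of_lt ht)).ne')

/-- Iterated integrals along an admissible path depend holomorphically on `t`. -/
theorem differentiableOn_iterInt {Γ : Subgroup SL(2, ℝ)} {p : ℝ → ℍ} {x y : ExtUHP Γ}
    (hp : IsPathFromTo p x y) (L : List ((ℍ → ℂ) × ℝ)) (hL : ∀ e ∈ L, IsCuspidal Γ e.1)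
    {s : ℝ} (hs : s ∈ Icc (0 : ℝ) 1) :
    DifferentiableOn ℂ (Function.extend (fun t : LHP => t.1) (fun t => iterInt p t L s) 0)
      {t : ℂ | t.im < 0} := by
  induction L generalizing s with
  | nil =>
    refine (differentiableOn_const (1 : ℂ)).congr fun t ht => ?_
    obtain ⟨t, rfl⟩ := exists_lhp_eq ht
    exact extend_apply_lhp (fun t => iterInt p t [] s) t
  | cons e L ih =>
    have hcons := hL
    obtain ⟨f, w⟩ := e
    have hf : IsCuspidal Γ f := hL (f, w) List.mem_cons_self
    have hL : ∀ e ∈ L, IsCuspidal Γ e.1 := fun e he => hL e (List.mem_cons_of_mem _ he)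
    obtain ⟨_, _, _, _, hconv⟩ := exists_bound_iterInt hp ((f, w) :: L) hcons
    obtain ⟨C, a, hC, ha, hbd⟩ := exists_bound_iterInt hp L hL
    have hmaj := integrableOn_pathMajorant hp hf (abs_nonneg w)
    have hsub : Ioc 0 s ⊆ Ioc (0 : ℝ) 1 := Ioc_subset_Ioc_right hs.2
    set K : ℂ → ℝ → ℂ := fun t r => f (p r) * ((p r : ℂ) - t) ^ (w : ℂ) *
      Function.extend (fun t : LHP => t.1) (fun t => iterInt p t L r) 0 t *
        deriv (fun r => (p r : ℂ)) r
    have hK : ∀ t : LHP, K t.1 = pathIntegrand p t f w (iterInt p t L) := fun t => by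
      funext r
      simp only [K, pathIntegrand]
      rw [extend_apply_lhp]
    have main : DifferentiableOn ℂ (fun t => ∫ r in Ioc 0 s, K t r) {t : ℂ | t.im < 0} := by
      refine differentiableOn_integral_of_dominated isOpen_im_neg (fun t ht => ?_) ?_ ?_
      · obtain ⟨t, rfl⟩ := exists_lhp_eq ht
        have h1 := ((intervalIntegrable_iff_integrableOn_Ioc_of_le zero_le_one).1
          (hconv t).1.1).mono_set hsub
        rw [← hK] at h1
        exact h1.aestronglyMeasurable
      · refine (ae_restrict_iff' measurableSet_Ioc).2 (Eventually.of_forall fun r hr => ?_)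
        refine DifferentiableOn.mul_const (DifferentiableOn.mul (DifferentiableOn.const_mul ?_ _)
          (ih hL ⟨hr.1.le, hr.2.trans hs.2⟩)) _
        refine DifferentiableOn.cpow (by fun_prop) (by fun_prop) fun t ht => Or.inr (ne_of_gt ?_)
        change 0 < ((p r : ℂ) - t).im
        have h1 : t.im < 0 := ht
        rw [Complex.sub_im, coe_im]
        linarith [(p r).im_pos]
      · intro T hT hTc
        -- On compact sets of t, `lhpSize` is bounded, so a multiple of the path majorant dominates.
        -- The maximum with 1 keeps the base positive even for empty T.
        obtain ⟨S, hS⟩ := hTc.bddAbove_image (continuousOn_lhpSize.mono hT)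
        refine ⟨fun r => C * (max S 1) ^ (|w| + a) * pathMajorant p f |w| r, ?_, ?_⟩
        · exact (((intervalIntegrable_iff_integrableOn_Ioc_of_le zero_le_one).1 hmaj).mono_set
            hsub).const_mul _
        · refine (ae_restrict_iff' measurableSet_Ioc).2
            (Eventually.of_forall fun r hr t ht => ?_)
          have hr' : r ∈ Icc (0 : ℝ) 1 := ⟨hr.1.le, hr.2.trans hs.2⟩
          obtain ⟨t, rfl⟩ := exists_lhp_eq (hT ht)
          have h1 := norm_pathIntegrand_le p t f w (iterInt p t L) r
          rw [← hK] at h1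
          have h2 := one_le_lhpSize t.1
          have h3 : lhpSize t.1 ≤ max S 1 := (hS (mem_image_of_mem _ ht)).trans (le_max_left _ _)
          have h4 := pathMajorant_nonneg p f |w| r
          have hpos : 0 < lhpSize t.1 := by linarith
          refine h1.trans ?_
          calc _ ≤ pathMajorant p f |w| r * lhpSize t.1 ^ |w| * (C * lhpSize t.1 ^ a) := by
                gcongr; exact (hbd t).2.2 r hr'
            _ = C * lhpSize t.1 ^ (|w| + a) * pathMajorant p f |w| r := by
                rw [Real.rpow_add hpos]; ring
            _ ≤ C * max S 1 ^ (|w| + a) * pathMajorant p f |w| r := by gcongr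
    refine main.congr fun t ht => ?_
    obtain ⟨t, rfl⟩ := exists_lhp_eq ht
    rw [extend_apply_lhp (fun t => iterInt p t ((f, w) :: L) s), hK, iterInt,
      intervalIntegral.integral_of_le hs.1]

/-! ## Polynomial growth -/

/-- Since |Im t| ≤ |t|, one of |t| and 1/|Im t| is at least 1; hence `lhpSize t` is at most three
times their maximum. -/
lemma lhpSize_rpow_le {t : ℂ} (ht : t.im < 0) {a : ℝ} (ha : 0 ≤ a) :
    lhpSize t ^ a ≤ 3 ^ a * 2 * (‖t‖ ^ a + |t.im| ^ (-a)) := by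
  have him : 0 < |t.im| := abs_pos.2 ht.ne
  have hn : 0 < ‖t‖ := him.trans_le (Complex.abs_im_le_norm t)
  have hinv : |t.im| ^ (-a) = (|t.im|⁻¹) ^ a := by
    rw [Real.rpow_neg him.le, Real.inv_rpow him.le]
  have h1 : 0 ≤ ‖t‖ ^ a := by positivity
  have h2 : 0 ≤ (|t.im|⁻¹) ^ a := by positivity
  have h3 : (0 : ℝ) < 3 ^ a := by positivity
  have hm : 1 ≤ max ‖t‖ |t.im|⁻¹ := by
    rcases le_total 1 ‖t‖ with h | h
    · exact h.trans (le_max_left _ _)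
    · exact ((one_le_inv₀ him).2 ((Complex.abs_im_le_norm t).trans h)).trans (le_max_right _ _)
  have hle : lhpSize t ≤ 3 * max ‖t‖ |t.im|⁻¹ := by
    unfold lhpSize
    linarith [le_max_left ‖t‖ |t.im|⁻¹, le_max_right ‖t‖ |t.im|⁻¹]
  have hpos : 0 ≤ lhpSize t := by linarith [one_le_lhpSize t]
  rw [hinv]
  calc lhpSize t ^ a ≤ (3 * max ‖t‖ |t.im|⁻¹) ^ a := Real.rpow_le_rpow hpos hle ha
    _ = 3 ^ a * (max ‖t‖ |t.im|⁻¹) ^ a := Real.mul_rpow (by norm_num) (by linarith)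
    _ ≤ 3 ^ a * (‖t‖ ^ a + (|t.im|⁻¹) ^ a) := by
        refine mul_le_mul_of_nonneg_left ?_ h3.le
        rcases max_choice ‖t‖ |t.im|⁻¹ with h | h <;> rw [h] <;> linarith
    _ ≤ _ := by nlinarith

/-- A holomorphic function on the lower half-plane that is bounded by a power of `lhpSize` has
polynomial growth. -/
lemma isPolyGrowth_of_bound {φ : LHP → ℂ}
    (hd : DifferentiableOn ℂ (Function.extend (fun t : LHP => t.1) φ 0) {t : ℂ | t.im < 0})
    {C a : ℝ} (hC : 0 ≤ C) (ha : 0 ≤ a) (hb : ∀ t : LHP, ‖φ t‖ ≤ C * lhpSize t.1 ^ a) :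
    IsPolyGrowth φ := by
  refine ⟨hd, a, C * (3 ^ a * 2), ha, fun t => (hb t).trans ?_⟩
  rw [mul_assoc]
  exact mul_le_mul_of_nonneg_left (lhpSize_rpow_le t.2 ha) hC

namespace WeightSystem.CuspFamily

variable {Γ : Subgroup SL(2, ℝ)} {ℓ : ℕ} {A : WeightSystem Γ ℓ} (h : A.CuspFamily)

lemma differentiableOn_R (L : List A.monomials) (y x : ExtUHP Γ) :
    DifferentiableOn ℂ (Function.extend (fun t : LHP => t.1) (h.R L y x) 0) {t : ℂ | t.im < 0} :=
  differentiableOn_iterInt (isPathFromTo_stdPath x y) _ (h.isCuspidal_factors L)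
    (right_mem_Icc.2 zero_le_one)

lemma exists_bound_R (L : List A.monomials) (y x : ExtUHP Γ) :
    ∃ C a : ℝ, 0 ≤ C ∧ 0 ≤ a ∧ ∀ t : LHP, ‖h.R L y x t‖ ≤ C * lhpSize t.1 ^ a := by
  obtain ⟨C, a, hC, ha, hb⟩ := exists_bound_iterInt (isPathFromTo_stdPath x y) _
    (h.isCuspidal_factors L)
  exact ⟨C, a, hC, ha, fun t => (hb t).2.2 1 (right_mem_Icc.2 zero_le_one)⟩

lemma isPolyGrowth_J (y x : ExtUHP Γ) (m : List (Fin ℓ)) : IsPolyGrowth (h.J y x m) := by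
  choose C a hC ha hb using fun L : List A.monomials => h.exists_bound_R L y x
  set S := (A.finite_factorizations m).toFinset
  -- As `lhpSize` is at least 1, the sum of the finitely many nonnegative exponents serves as a
  -- common exponent.
  refine isPolyGrowth_of_bound (C := ∑ L ∈ S, C L) (a := ∑ L ∈ S, a L) ?_
    (Finset.sum_nonneg fun L _ => hC L) (Finset.sum_nonneg fun L _ => ha L) fun t => ?_
  · have h1 : DifferentiableOn ℂ (fun t => ∑ L ∈ S,
        Function.extend (fun t : LHP => t.1) (h.R L y x) 0 t) {t : ℂ | t.im < 0} :=
      DifferentiableOn.fun_sum fun L _ => h.differentiableOn_R L y x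
    refine h1.congr fun t ht => ?_
    obtain ⟨t, rfl⟩ := exists_lhp_eq ht
    refine (extend_apply_lhp (h.J y x m) t).trans ((h.J_apply y x m t).trans ?_)
    exact Finset.sum_congr rfl fun L _ => (extend_apply_lhp (h.R L y x) t).symm
  · rw [J_apply, Finset.sum_mul]
    refine (norm_sum_le _ _).trans (Finset.sum_le_sum fun L hL => (hb L t).trans ?_)
    refine mul_le_mul_of_nonneg_left (Real.rpow_le_rpow_of_exponent_le (one_le_lhpSize t.1) ?_)
      (hC L)
    exact Finset.single_le_sum (fun L _ => ha L) hL

theorem J_mem_unipotent (y x : ExtUHP Γ) : h.J y x ∈ A.unipotent :=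
  ⟨⟨h.isPolyGrowth_J y x, 1, h.J_nil y x⟩, h.J_nil y x⟩

end WeightSystem.CuspFamily

theorem proposition6p1 (Γ : Subgroup SL(2, ℝ)) (hdisc : DiscreteTopology Γ)
    (hcof : IsCofinite Γ) (ℓ : ℕ) (A : WeightSystem Γ ℓ) (h : A.CuspFamily) :
    -- the iterated integrals converge, and they do not depend on the path of integration
    (∀ (L : List A.monomials) (y x : ExtUHP Γ) (t : LHP) (p : ℝ → ℍ), IsPathFromTo p x y →
      IterConverges p t (h.factors L) ∧ iterInt p t (h.factors L) 1 = h.R L y x t) ∧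
    -- the series is an element of the group `𝒩(𝒜)`
    (∀ y x : ExtUHP Γ, h.J y x ∈ A.unipotent) ∧
    -- the four properties
    (∀ (γ : Γ) (y x : ExtUHP Γ), h.J (γ⁻¹ • y) (γ⁻¹ • x) = A.slash (h.J y x) γ) ∧
    (∀ x : ExtUHP Γ, h.J x x = 1) ∧
    (∀ z y x : ExtUHP Γ, h.J z x = h.J z y * h.J y x) ∧
    (∀ y x : ExtUHP Γ, h.J x y * h.J y x = 1 ∧ h.J y x * h.J x y = 1) := by
  refine ⟨fun L y x t p hp => ⟨?_, ?_⟩, h.J_mem_unipotent, h.J_inv_smul, h.J_self, h.J_mul_J,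
    fun y x => ⟨?_, ?_⟩⟩
  · obtain ⟨_, _, _, _, hc⟩ := exists_bound_iterInt hp _ (h.isCuspidal_factors L)
    exact (hc t).1
  · exact iterInt_one_eq hp t (h.isCuspidal_factors L) (h.tendsto_R L y x t)
  · rw [← h.J_mul_J, h.J_self]
  · rw [← h.J_mul_J, h.J_self]
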